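/- Let $f:\mathbb R^p\to\mathbb R$ be convex and differentiable and let $L_j>0$ be such that $|\nabla_jf(x+he_j)-\nabla_jf(x)|\le L_j|h|$ for all $x\in\mathbb R^p$, $h\in\mathbb R$, $j\in[p]$. Let $g_j:\mathbb R\to\mathbb R\cup\{+\infty\}$ be proper, closed and bounded below, and such that $g_j/L_j+\frac\alpha2|\cdot|^2$ is convex for every $j$, with a common $\alpha<1$. Let $f$ and all $g_j$ be piecewise quadratic: the domain is a finite union of polyhedral sets, on each of which the function is a polynomial of degree at most $2$. Let $\Phi=f+g$, $g(\beta)=\sum_jg_j(\beta_j)$, let $\partial$ be the Fréchet subdifferential, let $\hat\beta$ be a critical point, i.e. $-\nabla f(\hat\beta)\in\partial g(\hat\beta)$, and let $\mathcal S=\{j:\partial g_j(\hat\beta_j)\text{ is a singleton}\}$ be its generalized support. Assume: - (non-degeneracy) $-\nabla_jf(\hat\beta)\in\operatorname{interior}\,\partial g_j(\hat\beta_j)$ for all $j\notin\mathcal S$; - (regularity) $f$ is $C^3$ around $\hat\beta$, and $g_j$ is (finite and) $C^3$ around $\hat\beta_j$ for all $j\in\mathcal S$; - (local strong convexity) $H:=\nabla^2_{\mathcal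 S,\mathcal S}f(\hat\beta)+\nabla^2_{\mathcal S,\mathcal S}g(\hat\beta)\succ0$. A *symmetric epoch* $E$ performs successively, for $j=1,\dots,p$ and then for $j=p,\dots,1$, the update $\beta_j\leftarrow\operatorname{prox}_{g_j/L_j}\big(\beta_j-\frac1{L_j}\nabla_jf(\beta)\big)$. Fix $M\ge1$. *Anderson accelerated coordinate descent* is any sequence $(\beta^{(k)})_{k\ge0}$ such that $\beta^{(k)}=E(\beta^{(k-1)})$ when $k\ge1$ is not a multiple of $M$, and such that, when $k\ge1$ is a multiple of $M$, $\beta^{(k)}$ is either the extrapolated point $\beta^{(k),\mathrm{extr}}=\sum_{i=1}^Mc_ix^{(i)}$ (extrapolation accepted) or $E(\beta^{(k-1)})$ (extrapolation rejected). Here $x^{(i)}=\beta^{(k-M+i)}$ for $0\le i<M$, $x^{(M)}=E(\beta^{(k-1)})$, $U=[x^{(1)}-x^{(0)},\dots,x^{(M)}-x^{(M-1)}]$, and $c$ minimizes $\|Uc\|_2$ subject to $\mathbf 1^\top c=1$ (that is, $c=(U^\top U)^{-1}\mathbf 1/\mathbf 1^\top(U^\top U)^{-1}\mathbf 1$ when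 $U^\top U$ is invertible). The rule that decides between acceptance and rejection is arbitrary: for example always accept, or accept if and only if $\Phi(\beta^{(k),\mathrm{extr}})<\Phi(E(\beta^{(k-1)}))$. Suppose that such a sequence converges to $\hat\beta$. Then there exist $K\in\mathbb N$ and a $C^1$ map $\psi:\mathbb R^{\mathcal S}\to\mathbb R^{\mathcal S}$ that coincides, in a neighbourhood of $\hat\beta_{\mathcal S}$, with the fixed-point map of symmetric coordinate descent on $\mathcal S$ (the coordinates in $\mathcal S$ are updated in increasing and then in decreasing order, those off $\mathcal S$ being frozen at $\hat\beta_{\mathcal S^c}$), such that the following holds. For all $k\ge K$, $$\beta^{(k)}_j=\hat\beta_j\ \text{ for all } j\notin\mathcal S,\qquad E(\beta^{(k)})_{\mathcal S}=\psi(\beta^{(k)}_{\mathcal S}).$$ Moreover, with $T=\mathcal J\psi(\hat\beta_{\mathcal S})$, $\rho(T)$ its spectral radius, $\zeta=\frac{1-\sqrt{1-\rho(T)}}{1+\sqrt{1-\rho(T)}}$, $B=(T-\mathrm{Id})^\top(T-\mathrm{Id})$, $\|x\|_B=\sqrt{x^\top Bx}$, $\kappa(H)=\|H\|_2\|H^{-1}\|_2$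 and $r=\sqrt{\kappa(H)}\,\frac{2\zeta^{M-1}}{1+\zeta^{2(M-1)}}$, one has $$\rho(T)<1.$$ Finally, the iterates of Anderson extrapolation converge at the accelerated rate: if the extrapolation is accepted at all sufficiently large multiples of $M$ (in particular if it is always accepted), or if $\rho(T)^M<r$ (whatever the extrapolations that are accepted), then for all $k\ge K$ $$\|\beta^{(k)}_{\mathcal S}-\hat\beta_{\mathcal S}\|_B\le r^{(k-K)/M}\,\|\beta^{(K)}_{\mathcal S}-\hat\beta_{\mathcal S}\|_B .$$ -/

import Mathlib

open Filter Topology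

noncomputable section

namespace AndersonCD

/-- Fréchet subdifferential of an extended-real-valued function: the continuous linear forms `v`
such that `h y ≥ h x + v (y - x) - o(‖y - x‖)`; empty where `h` is not finite. -/
def frechetSubdiff {E : Type*} [NormedAddCommGroup E] [NormedSpace ℝ E]
    (h : E → EReal) (x : E) : Set (E →L[ℝ] ℝ) :=
  {v | h x ≠ ⊤ ∧ h x ≠ ⊥ ∧ ∀ ε : ℝ, 0 < ε →
    ∀ᶠ y in 𝓝 x, h x + ((v (y - x) - ε * ‖y - x‖ : ℝ) : EReal) ≤ h y}

/-- Fréchet subdifferential of a function of one real variable, as a set of slopes. -/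
def subdiff (h : ℝ → EReal) (x : ℝ) : Set ℝ :=
  {v | v • (1 : ℝ →L[ℝ] ℝ) ∈ frechetSubdiff h x}

/-- Generalized support: the coordinates at which the Fréchet subdifferential is a singleton. -/
def gsupp {p : ℕ} (g : Fin p → ℝ → EReal) (β : Fin p → ℝ) : Finset (Fin p) :=
  open Classical in Finset.univ.filter fun j => ∃ v, subdiff (g j) (β j) = {v}

/-- The separable penalty `∑ j, g j (β j)`. -/
def penalty {p : ℕ} (g : Fin p → ℝ → EReal) (β : Fin p → ℝ) : EReal :=
  ∑ j, g j (β j)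

/-- Critical point of `f + ∑ j, g j`: `-∇ f (β)` is a Fréchet subgradient of the penalty. -/
def IsCritical {p : ℕ} (f : (Fin p → ℝ) → ℝ) (g : Fin p → ℝ → EReal) (β : Fin p → ℝ) : Prop :=
  -fderiv ℝ f β ∈ frechetSubdiff (penalty g) β

/-- The `j`-th partial derivative of `f` at `x`. -/
def partialDeriv {p : ℕ} (f : (Fin p → ℝ) → ℝ) (j : Fin p) (x : Fin p → ℝ) : ℝ :=
  fderiv ℝ f x (Pi.single j 1)

/-- `f` is convex, differentiable, and `∇_j f` is `L j`-Lipschitz along the `j`-th coordinate. -/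
structure SmoothPart {p : ℕ} (f : (Fin p → ℝ) → ℝ) (L : Fin p → ℝ) : Prop where
  convex : ConvexOn ℝ Set.univ f
  differentiable : Differentiable ℝ f
  pos : ∀ j, 0 < L j
  lipschitz : ∀ j x (h : ℝ),
    |partialDeriv f j (x + h • Pi.single j 1) - partialDeriv f j x| ≤ L j * |h|

/-- `g` is proper, closed and bounded below. -/
structure ProperClosedBelow (g : ℝ → EReal) : Prop where
  exists_ne_top : ∃ x, g x ≠ ⊤
  closed : LowerSemicontinuous g
  bddBelow : ∃ m : ℝ, ∀ x, (m : EReal) ≤ g x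

/-- `h + α |·|² / 2` is convex, i.e. its epigraph is convex. -/
def SemiConvex (α : ℝ) (h : ℝ → EReal) : Prop :=
  Convex ℝ {q : ℝ × ℝ | h q.1 + ((α * q.1 ^ 2 / 2 : ℝ) : EReal) ≤ (q.2 : EReal)}

/-- A polyhedral set: a finite intersection of closed half-spaces. -/
def IsPolyhedral {E : Type*} [AddCommGroup E] [Module ℝ E] (C : Set E) : Prop :=
  ∃ (m : ℕ) (a : Fin m → E →ₗ[ℝ] ℝ) (b : Fin m → ℝ), C = {x | ∀ i, a i x ≤ b i}

/-- Piecewise quadratic: the domain is a finite union of polyhedral sets, on each of which the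
function is a polynomial of degree at most two. -/
def PiecewiseQuadratic {E : Type*} [AddCommGroup E] [Module ℝ E] (h : E → EReal) : Prop :=
  ∃ (N : ℕ) (C : Fin N → Set E), (∀ i, IsPolyhedral (C i)) ∧ {x | h x ≠ ⊤} = ⋃ i, C i ∧
    ∀ i, ∃ (Q : QuadraticForm ℝ E) (l : E →ₗ[ℝ] ℝ) (c : ℝ),
      ∀ x ∈ C i, h x = ((Q x + l x + c : ℝ) : EReal)

/-- Every coordinate off the generalized support satisfies the strict optimality condition. -/
def NonDegenerate {p : ℕ} (f : (Fin p → ℝ) → ℝ) (g : Fin p → ℝ → EReal) (β : Fin p → ℝ) : Prop :=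
  ∀ j ∉ gsupp g β, -partialDeriv f j β ∈ interior (subdiff (g j) (β j))

/-- Local `C³` regularity of `f` at `β`, and of `g j` at `β j` for `j` in the support. -/
def LocallyC3 {p : ℕ} (f : (Fin p → ℝ) → ℝ) (g : Fin p → ℝ → EReal) (β : Fin p → ℝ) : Prop :=
  ContDiffAt ℝ 3 f β ∧ ∀ j ∈ gsupp g β,
    (∀ᶠ x in 𝓝 (β j), g j x ≠ ⊤ ∧ g j x ≠ ⊥) ∧
      ContDiffAt ℝ 3 (fun x => (g j x).toReal) (β j)

/-- The Hessian of `f + ∑ j, g j` at `β`, restricted to the generalized support. -/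
def hessian {p : ℕ} (f : (Fin p → ℝ) → ℝ) (g : Fin p → ℝ → EReal) (β : Fin p → ℝ) :
    Matrix (gsupp g β) (gsupp g β) ℝ :=
  Matrix.of (fun i j : gsupp g β => partialDeriv (partialDeriv f j) i β) +
    Matrix.diagonal fun j : gsupp g β => iteratedDeriv 2 (fun x => (g j x).toReal) (β j)

/-- `u` minimizes `v ↦ h v + (v - z)² / 2`. -/
def IsProx (h : ℝ → EReal) (z u : ℝ) : Prop :=
  ∀ v, h u + (((u - z) ^ 2 / 2 : ℝ) : EReal) ≤ h v + (((v - z) ^ 2 / 2 : ℝ) : EReal)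

/-- The proximal operator of `h` (with value `0` where the minimum is not attained). -/
def prox (h : ℝ → EReal) (z : ℝ) : ℝ :=
  open Classical in if hz : ∃ u, IsProx h z u then hz.choose else 0

/-- Proximal update of the `j`-th coordinate with step `1 / L j`. -/
def cdStep {p : ℕ} (f : (Fin p → ℝ) → ℝ) (g : Fin p → ℝ → EReal) (L : Fin p → ℝ)
    (β : Fin p → ℝ) (j : Fin p) : Fin p → ℝ :=
  Function.update β j
    (prox (fun x => g j x / (L j : EReal)) (β j - 1 / L j * partialDeriv f j β))

/-- One pass over the coordinates in `l`, in increasing and then in decreasing order. -/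
def symmSweep {p : ℕ} (f : (Fin p → ℝ) → ℝ) (g : Fin p → ℝ → EReal) (L : Fin p → ℝ)
    (l : List (Fin p)) (β : Fin p → ℝ) : Fin p → ℝ :=
  (l ++ l.reverse).foldl (cdStep f g L) β

/-- One epoch of symmetric coordinate descent: coordinates `1, …, p`, then `p, …, 1`. -/
def cdEpoch {p : ℕ} (f : (Fin p → ℝ) → ℝ) (g : Fin p → ℝ → EReal) (L : Fin p → ℝ) :
    (Fin p → ℝ) → (Fin p → ℝ) :=
  symmSweep f g L (List.finRange p)

/-- The successive differences `x (i + 1) - x i`, as the columns of a matrix. -/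
def differences {p M : ℕ} (x : Fin (M + 1) → Fin p → ℝ) : Matrix (Fin p) (Fin M) ℝ :=
  Matrix.of fun j i => x i.succ j - x i.castSucc j

/-- `c` minimizes `‖U c‖` under the constraint `∑ i, c i = 1`. By the lemma below this is the
closed form `c = (Uᵀ U)⁻¹ 1 / (1ᵀ (Uᵀ U)⁻¹ 1)` whenever `Uᵀ U` is invertible. -/
def IsAndersonWeights {p M : ℕ} (U : Matrix (Fin p) (Fin M) ℝ) (c : Fin M → ℝ) : Prop :=
  ∑ i, c i = 1 ∧ ∀ c' : Fin M → ℝ, ∑ i, c' i = 1 →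
    U.mulVec c ⬝ᵥ U.mulVec c ≤ U.mulVec c' ⬝ᵥ U.mulVec c'

/-- `y = ∑ i ∈ {1, …, M}, c i • x i` is an Anderson extrapolation of `x 0, …, x M`. -/
def IsAndersonExtrapolation {p M : ℕ} (x : Fin (M + 1) → Fin p → ℝ) (y : Fin p → ℝ) : Prop :=
  ∃ c : Fin M → ℝ, IsAndersonWeights (differences x) c ∧ y = ∑ i, c i • x i.succ

/-- Anderson accelerated coordinate descent. Every iterate is obtained by a symmetric epoch; at
each multiple `k` of `M`, `ex k` is the extrapolation of `β (k - M), …, β (k - 1)` and of the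
result of the epoch, and the next iterate is either the extrapolated point (extrapolation accepted)
or the plain result of the epoch (extrapolation rejected). The rule that decides between the two
is arbitrary: always accepting, or accepting when the objective is smaller, are instances. -/
structure IsAndersonCD {p : ℕ} (f : (Fin p → ℝ) → ℝ) (g : Fin p → ℝ → EReal) (L : Fin p → ℝ)
    (M : ℕ) (β ex : ℕ → Fin p → ℝ) : Prop where
  epoch : ∀ k, ¬ M ∣ k + 1 → β (k + 1) = cdEpoch f g L (β k)
  extrapolation : ∀ k, M ∣ k + 1 → IsAndersonExtrapolation
    (Fin.snoc (α := fun _ => Fin p → ℝ) (fun i : Fin M => β (k + 1 - M + i)) (cdEpoch f g L (β k)))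
    (ex (k + 1))
  choice : ∀ k, M ∣ k + 1 → β (k + 1) = ex (k + 1) ∨ β (k + 1) = cdEpoch f g L (β k)

/-- Restriction of a vector to the coordinates in `S`. -/
def restr {p : ℕ} (S : Finset (Fin p)) (x : Fin p → ℝ) : S → ℝ := fun s => x s

/-- The vector equal to `u` on `S` and to `β` off `S`. -/
def extend {p : ℕ} (S : Finset (Fin p)) (β : Fin p → ℝ) (u : S → ℝ) : Fin p → ℝ :=
  fun j => if h : j ∈ S then u ⟨j, h⟩ else β j

/-- The fixed-point map on `ℝ^S`, `S` the generalized support of `β`: update the coordinates in `S`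
in increasing and then in decreasing order, the coordinates off `S` being frozen at `β`. -/
def fixedPointMap {p : ℕ} (f : (Fin p → ℝ) → ℝ) (g : Fin p → ℝ → EReal) (L : Fin p → ℝ)
    (β : Fin p → ℝ) (u : gsupp g β → ℝ) : gsupp g β → ℝ :=
  restr (gsupp g β) (symmSweep f g L ((List.finRange p).filter (· ∈ gsupp g β))
    (extend (gsupp g β) β u))

variable {n : Type*} [Fintype n] [DecidableEq n]

/-- The Jacobian matrix of `ψ` at `x`. -/
def jacobian (ψ : (n → ℝ) → (n → ℝ)) (x : n → ℝ) : Matrix n n ℝ :=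
  LinearMap.toMatrix' (fderiv ℝ ψ x : (n → ℝ) →ₗ[ℝ] (n → ℝ))

/-- Spectral radius of a real matrix: the largest modulus of its complex eigenvalues. -/
def specRadius (A : Matrix n n ℝ) : ℝ :=
  (spectralRadius ℂ (A.map (algebraMap ℝ ℂ))).toReal

/-- Condition number `‖A‖ ‖A⁻¹‖` for the Euclidean operator norm. -/
def condNumber (A : Matrix n n ℝ) : ℝ :=
  ‖Matrix.toEuclideanCLM (𝕜 := ℝ) A‖ * ‖Matrix.toEuclideanCLM (𝕜 := ℝ) A⁻¹‖

/-- The seminorm `√(xᵀ B x)` of a positive semidefinite matrix `B`. -/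
def matNorm (B : Matrix n n ℝ) (x : n → ℝ) : ℝ := √(x ⬝ᵥ B.mulVec x)

/-- `ζ = (1 - √(1 - ρ)) / (1 + √(1 - ρ))`. -/
def zeta (ρ : ℝ) : ℝ := (1 - √(1 - ρ)) / (1 + √(1 - ρ))

/-- The contraction factor of `M` epochs, `√κ · 2 ζ^(M-1) / (1 + ζ^(2(M-1)))`. -/
def rate (κ ρ : ℝ) (M : ℕ) : ℝ :=
  √κ * (2 * zeta ρ ^ (M - 1) / (1 + zeta ρ ^ (2 * (M - 1))))

theorem isAndersonWeights_iff {p M : ℕ} (hM : 0 < M) (U : Matrix (Fin p) (Fin M) ℝ)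
    (hU : IsUnit (U.transpose * U).det) (c : Fin M → ℝ) :
    IsAndersonWeights U c ↔
      c = (∑ i, (U.transpose * U)⁻¹.mulVec 1 i)⁻¹ • (U.transpose * U)⁻¹.mulVec 1 := by
  set G := U.transpose * U with hG
  set z := G⁻¹.mulVec 1 with hz
  have hGz : G.mulVec z = 1 := by
    rw [hz, Matrix.mulVec_mulVec, Matrix.mul_nonsing_inv _ hU, Matrix.one_mulVec]
  have key : ∀ a b, U.mulVec a ⬝ᵥ U.mulVec b = a ⬝ᵥ G.mulVec b := by
    intro a b
    rw [hG, ← Matrix.mulVec_mulVec, Matrix.dotProduct_mulVec a U.transpose, Matrix.vecMul_transpose]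
  have inj : ∀ d, U.mulVec d ⬝ᵥ U.mulVec d = 0 → d = 0 := by
    intro d hd
    have h0 : U.mulVec d = 0 := dotProduct_self_eq_zero.1 hd
    have h1 : G.mulVec d = 0 := by rw [hG, ← Matrix.mulVec_mulVec, h0, Matrix.mulVec_zero]
    have h2 : G⁻¹.mulVec (G.mulVec d) = d := by
      rw [Matrix.mulVec_mulVec, Matrix.nonsing_inv_mul _ hU, Matrix.one_mulVec]
    rw [← h2, h1, Matrix.mulVec_zero]
  have hs : ∑ i, z i ≠ 0 := by
    intro h
    have h1 : z = 0 := inj z (by rw [key, hGz, dotProduct_one, h])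
    have h2 := congrFun hGz ⟨0, hM⟩
    rw [h1, Matrix.mulVec_zero] at h2
    simp at h2
  set c0 := (∑ i, z i)⁻¹ • z with hc0
  have hsum0 : ∑ i, c0 i = 1 := by
    simp only [hc0, Pi.smul_apply, smul_eq_mul, ← Finset.mul_sum]
    exact inv_mul_cancel₀ hs
  have expand : ∀ c' : Fin M → ℝ, ∑ i, c' i = 1 → U.mulVec c' ⬝ᵥ U.mulVec c' =
      U.mulVec c0 ⬝ᵥ U.mulVec c0 + U.mulVec (c' - c0) ⬝ᵥ U.mulVec (c' - c0) := by
    intro c' h'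
    have horth : U.mulVec (c' - c0) ⬝ᵥ U.mulVec c0 = 0 := by
      rw [key, hc0, Matrix.mulVec_smul, hGz, dotProduct_smul, dotProduct_one, ← hc0]
      simp [Finset.sum_sub_distrib, h', hsum0]
    have h1 : U.mulVec c' = U.mulVec (c' - c0) + U.mulVec c0 := by
      rw [← Matrix.mulVec_add]; simp
    rw [h1, dotProduct_add, add_dotProduct, add_dotProduct, horth,
      dotProduct_comm (U.mulVec c0) (U.mulVec (c' - c0)), horth]
    ring
  constructor
  · rintro ⟨h1, h2⟩
    have h3 := h2 c0 hsum0
    rw [expand c h1] at h3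
    have h4 : 0 ≤ U.mulVec (c - c0) ⬝ᵥ U.mulVec (c - c0) :=
      Finset.sum_nonneg fun i _ => mul_self_nonneg _
    exact sub_eq_zero.1 (inj _ (by linarith))
  · intro h
    rw [h]
    refine ⟨hsum0, fun c' h' => ?_⟩
    rw [expand c' h']
    have h4 : 0 ≤ U.mulVec (c' - c0) ⬝ᵥ U.mulVec (c' - c0) :=
      Finset.sum_nonneg fun i _ => mul_self_nonneg _
    linarith

end AndersonCD

end

/-!
Near the critical point everything is affine. A piecewise quadratic function that is `C²` at a point
is quadratic near it (`eventually_fderiv_affine`): the interiors of its pieces are dense, so its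
continuous second derivative takes finitely many values there. Semiconvexity turns a Fréchet
subgradient `v` of `g` at `u` into the identity `prox_{g/L} (u + v / L) = u` (`prox_div_eq`). Off the
generalized support `S` the subdifferential has interior, so the proximal update is locally
constant; on `S` it is a gradient step for the quadratic form `H`, of length `1 / γ j` with
`H j j ≤ γ j` (`eventually_cdStep_eq`). A symmetric epoch therefore sends the coordinates off `S` to
their limit, and acts on `S` as the matrix `T` of a palindromic product of coordinate steps. The map
`ψ` is the affine map with linear part `T`.

With `R = H ^ (1 / 2)` one has `R T R⁻¹ = Qᵀ Q`, where `Q` strictly decreases the Euclidean norm,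
so `T` has real eigenvalues in `[0, 1)`, and a polynomial `F` in `T` satisfies
`‖F(T)‖ ≤ √κ(H) · sup_{[0, ρ]} |F|` (`sweepMatrix_spectral`).

The residuals `w k = (T - 1) (β k - βhat)` have the norm that appears in the conclusion. An accepted
extrapolation replaces the residual `w` of the beginning of the cycle by `T v`, where `v` is
minimal among the `F(T) w` with `F(1) = 1` and `deg F < M`. If the previous accepted extrapolation
gave `T v₀` and `a` rejected cycles followed it, then `w = T ^ (1 + a M) v₀`, and the Chebyshev
polynomial gives `‖v‖ ≤ r ρ (ρ ^ M) ^ a ‖v₀‖`: the factor `√κ(H)` is paid once per acceptance, and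
the final step of `T` gains a factor `ρ < 1`. When there are no rejections, or when `ρ ^ M < r`,
this is a decay at a rate `s < r` per cycle (`residual_decay`). Thus `‖w k‖ / r ^ (k / M)` tends to
zero, and the bound with constant one holds from an index `K` where this quotient is maximal
(`exists_rate_index`).
-/

namespace AndersonCD

open Matrix Polynomial

/-! ### Chebyshev polynomials on `[0, ρ]` -/

/-- The value of a Chebyshev polynomial outside `[-1, 1]`, at the image of `z` under the Joukowsky
map. -/
theorem chebyshev_eval_joukowsky (n : ℕ) {z : ℝ} (hz : z ≠ 0) :
    (Chebyshev.T ℝ n).eval ((z + z⁻¹) / 2) = (z ^ n + (z⁻¹) ^ n) / 2 := by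
  induction n using Nat.twoStepInduction with
  | zero => simp
  | one => simp
  | more n ih1 ih2 =>
    push_cast at ih1 ih2 ⊢
    rw [Chebyshev.T_add_two]
    simp only [eval_sub, eval_mul, eval_ofNat, eval_X, ih1, ih2, inv_pow]
    field_simp
    ring

theorem zeta_pos {ρ : ℝ} (h0 : 0 < ρ) : 0 < zeta ρ := by
  have hs : √(1 - ρ) < 1 := by
    rw [Real.sqrt_lt' one_pos]
    linarith
  exact div_pos (by linarith) (by positivity)

theorem zeta_add_inv {ρ : ℝ} (h0 : 0 < ρ) (h1 : ρ < 1) :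
    (zeta ρ + (zeta ρ)⁻¹) / 2 = 2 / ρ - 1 := by
  have hs : √(1 - ρ) < 1 := by
    rw [Real.sqrt_lt' one_pos]
    linarith
  have hs0 := Real.sqrt_nonneg (1 - ρ)
  have hsq := Real.sq_sqrt (show 0 ≤ 1 - ρ by linarith)
  have hρ : ρ = 1 - √(1 - ρ) ^ 2 := by linarith
  unfold zeta
  set s := √(1 - ρ)
  have h2 : 1 - s ≠ 0 := by linarith
  have h3 : 1 + s ≠ 0 := by linarith
  have h4 : 1 - s ^ 2 ≠ 0 := by linarith
  rw [hρ]
  field_simp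
  ring

/-- The scaled and shifted Chebyshev polynomial: normalized at `1`, it deviates from zero on
`[0, ρ]` by at most `2 ζ ^ n / (1 + ζ ^ (2 n))`. -/
theorem exists_chebyshev_poly (n : ℕ) {ρ : ℝ} (h0 : 0 < ρ) (h1 : ρ < 1) :
    ∃ F : ℝ[X], F.natDegree ≤ n ∧ F.eval 1 = 1 ∧
      ∀ x ∈ Set.Icc 0 ρ, |F.eval x| ≤ 2 * zeta ρ ^ n / (1 + zeta ρ ^ (2 * n)) := by
  have hz := zeta_pos h0
  set z := zeta ρ with hzdef
  set t := (z ^ n + (z⁻¹) ^ n) / 2 with ht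
  have htpos : 0 < t := by positivity
  set A : ℝ[X] := C (2 / ρ) * X - 1 with hA
  have hAe : ∀ x, A.eval x = 2 / ρ * x - 1 := fun x => by simp [hA]
  have hcomp : ((Chebyshev.T ℝ n).comp A).eval 1 = t := by
    rw [eval_comp, hAe, mul_one, ← zeta_add_inv h0 h1, chebyshev_eval_joukowsky n hz.ne']
  refine ⟨C t⁻¹ * (Chebyshev.T ℝ n).comp A, ?_, ?_, ?_⟩
  · refine (natDegree_C_mul_le _ _).trans (natDegree_comp_le.trans ?_)
    rw [Chebyshev.natDegree_T, Int.natAbs_natCast]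
    have : A.natDegree ≤ 1 := by
      refine (natDegree_sub_le _ _).trans ?_
      simpa using natDegree_C_mul_le (2 / ρ) (X : ℝ[X])
    nlinarith
  · rw [eval_mul, eval_C, hcomp, inv_mul_cancel₀ htpos.ne']
  · intro x hx
    have hb : |A.eval x| ≤ 1 := by
      rw [hAe, abs_le]
      have h2 : 2 / ρ * x ≤ 2 / ρ * ρ := by
        have := hx.2
        gcongr
      have h3 : 0 ≤ 2 / ρ * x := mul_nonneg (by positivity) hx.1
      have h4 : 2 / ρ * ρ = 2 := by field_simp
      constructor <;> linarith
    have h5 := Chebyshev.abs_eval_T_real_le_one n hb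
    rw [eval_mul, eval_C, eval_comp, abs_mul, abs_of_pos (inv_pos.2 htpos)]
    calc t⁻¹ * |(Chebyshev.T ℝ n).eval (A.eval x)| ≤ t⁻¹ * 1 := by gcongr
      _ = 2 * z ^ n / (1 + z ^ (2 * n)) := by
        rw [ht, two_mul n, pow_add, inv_pow]
        field_simp
        ring

/-! ### The linearized symmetric coordinate descent -/

section Sweep

open scoped Matrix.Norms.L2Operator

theorem norm_mulVec_le {n : Type*} [Fintype n] [DecidableEq n] (A : Matrix n n ℝ) (x : n → ℝ) :
    ‖WithLp.toLp 2 (A *ᵥ x)‖ ≤ ‖A‖ * ‖WithLp.toLp 2 x‖ :=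
  l2_opNorm_mulVec A (WithLp.toLp 2 x)

theorem norm_toLp_eq_sqrt {n : Type*} [Fintype n] (x : n → ℝ) :
    ‖(WithLp.toLp 2 x : EuclideanSpace ℝ n)‖ = √(x ⬝ᵥ x) := by
  rw [EuclideanSpace.norm_eq]
  simp [dotProduct, ← sq]

/-- The seminorm attached to `(T - 1)ᵀ (T - 1)` is the Euclidean norm of the residual. -/
theorem matNorm_residual {n : Type*} [Fintype n] (A : Matrix n n ℝ) (x : n → ℝ) :
    matNorm (Aᵀ * A) x = ‖(WithLp.toLp 2 (A *ᵥ x) : EuclideanSpace ℝ n)‖ := by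
  rw [norm_toLp_eq_sqrt, matNorm, ← mulVec_mulVec, dotProduct_mulVec, vecMul_transpose]

variable {n : Type*} [Fintype n] [DecidableEq n]

/-- The matrix of the gradient step of length `1 / γ j` along the coordinate `j`, for the quadratic
form with matrix `H`. -/
noncomputable def coordMatrix (H : Matrix n n ℝ) (γ : n → ℝ) (j : n) : Matrix n n ℝ :=
  1 - (γ j)⁻¹ • vecMulVec (Pi.single j 1) (H j)

theorem coordMatrix_mulVec (H : Matrix n n ℝ) (γ : n → ℝ) (j : n) (x : n → ℝ) :
    coordMatrix H γ j *ᵥ x = x - ((γ j)⁻¹ * (H *ᵥ x) j) • Pi.single j 1 := by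
  rw [coordMatrix, sub_mulVec, one_mulVec, smul_mulVec, vecMulVec_mulVec]
  ext i
  simp [mulVec, Pi.single_apply]

/-- Each coordinate step is self-adjoint for the inner product defined by `H`. -/
theorem mul_coordMatrix {H : Matrix n n ℝ} (hH : Hᵀ = H) (γ : n → ℝ) (j : n) :
    H * coordMatrix H γ j = (coordMatrix H γ j)ᵀ * H := by
  have h : ∀ i k, H i k = H k i := fun i k => congrFun (congrFun hH k) i
  have h1 : H *ᵥ Pi.single j 1 = H j := by
    ext i
    simp [h i j]
  have h2 : Pi.single j 1 ᵥ* H = H j := by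
    ext i
    simp
  simp only [coordMatrix, mul_sub, transpose_sub, transpose_one, transpose_smul,
    transpose_vecMulVec, sub_mul, mul_one, one_mul, mul_smul_comm, smul_mul_assoc, mul_vecMulVec,
    vecMulVec_mul, h1, h2]

/-- The adjoint of a product of coordinate steps, for the inner product defined by `H`, is the
product in the reverse order. -/
theorem mul_listProd {H : Matrix n n ℝ} (hH : Hᵀ = H) (γ : n → ℝ) (l : List n) :
    H * (l.map (coordMatrix H γ)).prod = ((l.reverse.map (coordMatrix H γ)).prod)ᵀ * H := by
  induction l with
  | nil => simp
  | cons j l ih =>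
    rw [List.map_cons, List.prod_cons, ← mul_assoc, mul_coordMatrix hH, mul_assoc, ih,
      List.reverse_cons, List.map_append, List.prod_append, transpose_mul, ← mul_assoc]
    simp

/-- Since `H j j ≤ γ j`, a coordinate step does not overshoot, and decreases the energy. -/
theorem energy_step {H : Matrix n n ℝ} (hH : H.PosDef) {γ : n → ℝ} (hγ : ∀ j, H j j ≤ γ j)
    (j : n) (x : n → ℝ) :
    (coordMatrix H γ j *ᵥ x) ⬝ᵥ H *ᵥ (coordMatrix H γ j *ᵥ x) ≤
      x ⬝ᵥ H *ᵥ x - (γ j)⁻¹ * (H *ᵥ x) j ^ 2 := by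
  have hHt : Hᵀ = H := show H.IsSymm by simpa using hH.1
  have hγ0 : 0 < γ j := hH.diag_pos.trans_le (hγ j)
  have h1 : x ⬝ᵥ H *ᵥ Pi.single j 1 = (H *ᵥ x) j := by
    rw [dotProduct_mulVec, ← mulVec_transpose, hHt, dotProduct_single, mul_one]
  rw [coordMatrix_mulVec]
  set d := (H *ᵥ x) j
  have h2 : (x - ((γ j)⁻¹ * d) • Pi.single j 1) ⬝ᵥ H *ᵥ (x - ((γ j)⁻¹ * d) • Pi.single j 1) =
      x ⬝ᵥ H *ᵥ x - 2 * ((γ j)⁻¹ * d ^ 2) + ((γ j)⁻¹ * d) ^ 2 * H j j := by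
    rw [mulVec_sub, mulVec_smul, dotProduct_sub, sub_dotProduct, sub_dotProduct, dotProduct_smul,
      dotProduct_smul, smul_dotProduct, smul_dotProduct, h1, single_dotProduct, single_dotProduct]
    simp only [smul_eq_mul, one_mul, mulVec_single, MulOpposite.op_one, one_smul, col_apply]
    change _ - _ * d - (_ - _) = _
    ring
  have h3 : ((γ j)⁻¹ * d) ^ 2 * H j j ≤ ((γ j)⁻¹ * d) ^ 2 * γ j := by
    have := hγ j
    gcongr
  have h4 : ((γ j)⁻¹ * d) ^ 2 * γ j = (γ j)⁻¹ * d ^ 2 := by field_simp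
  rw [h2]
  linarith

/-- Coordinate steps strictly decrease the energy, unless the residual `H x` vanishes along all
the coordinates that are updated. -/
theorem energy_sweep {H : Matrix n n ℝ} (hH : H.PosDef) {γ : n → ℝ} (hγ : ∀ j, H j j ≤ γ j)
    (l : List n) (x : n → ℝ) :
    let W := (l.reverse.map (coordMatrix H γ)).prod
    (W *ᵥ x) ⬝ᵥ H *ᵥ (W *ᵥ x) < x ⬝ᵥ H *ᵥ x ∨
      (∀ j ∈ l, (H *ᵥ x) j = 0) ∧ (W *ᵥ x) ⬝ᵥ H *ᵥ (W *ᵥ x) ≤ x ⬝ᵥ H *ᵥ x := by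
  induction l generalizing x with
  | nil => simp
  | cons j l ih =>
    intro W
    have hW : W *ᵥ x = (l.reverse.map (coordMatrix H γ)).prod *ᵥ (coordMatrix H γ j *ᵥ x) := by
      simp [W, mulVec_mulVec]
    have hγ0 : 0 < γ j := hH.diag_pos.trans_le (hγ j)
    by_cases hj : (H *ᵥ x) j = 0
    · have hx : coordMatrix H γ j *ᵥ x = x := by simp [coordMatrix_mulVec, hj]
      rw [hW, hx]
      rcases ih x with h | ⟨h1, h2⟩
      · exact Or.inl h
      · exact Or.inr ⟨by simpa [hj] using h1, h2⟩
    · left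
      have h1 := energy_step hH hγ j x
      have h2 : 0 < (γ j)⁻¹ * (H *ᵥ x) j ^ 2 := by positivity
      have h3 := ih (coordMatrix H γ j *ᵥ x)
      rw [hW]
      rcases h3 with h | ⟨-, h⟩
      · exact h.trans_le (by linarith)
      · exact h.trans_lt (by linarith)

theorem exists_symmetric_sqrt {H : Matrix n n ℝ} (hH : H.PosDef) :
    ∃ R : Matrix n n ℝ, Rᵀ = R ∧ R * R = H := by
  open scoped MatrixOrder in
  refine ⟨CFC.sqrt H, ?_, CFC.sqrt_mul_sqrt_self H hH.posSemidef.nonneg⟩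
  have := (nonneg_iff_posSemidef.1 (CFC.sqrt_nonneg H)).1
  exact show (CFC.sqrt H).IsSymm by simpa using this

/-- The condition number of `H ^ (1 / 2)` is `√κ(H)`. -/
theorem norm_sqrt_mul_norm_inv {H R : Matrix n n ℝ} (hR : Rᵀ = R) (hRR : R * R = H) :
    ‖R⁻¹‖ * ‖R‖ = √(condNumber H) := by
  have hRi : (R⁻¹)ᵀ = R⁻¹ := by rw [transpose_nonsing_inv, hR]
  have h1 : ‖H‖ = ‖R‖ * ‖R‖ := by
    have := l2_opNorm_conjTranspose_mul_self R
    rwa [conjTranspose_eq_transpose_of_trivial, hR, hRR] at this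
  have h2 : ‖H⁻¹‖ = ‖R⁻¹‖ * ‖R⁻¹‖ := by
    have := l2_opNorm_conjTranspose_mul_self R⁻¹
    rwa [conjTranspose_eq_transpose_of_trivial, hRi, ← Matrix.mul_inv_rev, hRR] at this
  rw [condNumber, ← cstar_norm_def, ← cstar_norm_def, h1, h2,
    show ‖R‖ * ‖R‖ * (‖R⁻¹‖ * ‖R⁻¹‖) = (‖R⁻¹‖ * ‖R‖) ^ 2 by ring, Real.sqrt_sq (by positivity)]

/-- The matrix of one symmetric sweep over the list `l` of coordinates: they are updated in the order
of `l` and then in the reverse order. The product is palindromic, so that the order of its factors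
is also the order of the updates. -/
noncomputable def sweepMatrix (H : Matrix n n ℝ) (γ : n → ℝ) (l : List n) : Matrix n n ℝ :=
  ((l ++ l.reverse).map (coordMatrix H γ)).prod

/-- With `R = H ^ (1 / 2)`, a symmetric sweep `T` satisfies `R T R⁻¹ = Qᵀ Q`, where `Q` strictly
decreases the norm. Hence `T` is diagonalizable with eigenvalues in `[0, 1)`, by a change of basis
of condition number `√κ(H)`. -/
theorem exists_diagonalization {H : Matrix n n ℝ} (hH : H.PosDef) {γ : n → ℝ}
    (hγ : ∀ j, H j j ≤ γ j) {l : List n} (hl : ∀ j, j ∈ l) :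
    ∃ (X Y : Matrix n n ℝ) (d : n → ℝ), X * Y = 1 ∧ Y * X = 1 ∧
      sweepMatrix H γ l = X * diagonal d * Y ∧ (∀ i, 0 ≤ d i ∧ d i < 1) ∧
      ‖X‖ * ‖Y‖ ≤ √(condNumber H) := by
  obtain ⟨R, hR, hRR⟩ := exists_symmetric_sqrt hH
  have hHt : Hᵀ = H := show H.IsSymm by simpa using hH.1
  have hRu : IsUnit R.det := by
    have : IsUnit (R * R).det := by
      rw [hRR]
      exact (isUnit_iff_isUnit_det _).1 hH.isUnit
    rw [det_mul] at this
    exact isUnit_of_mul_isUnit_left this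
  have hRi : R * R⁻¹ = 1 := mul_nonsing_inv _ hRu
  have hiR : R⁻¹ * R = 1 := nonsing_inv_mul _ hRu
  have hRit : (R⁻¹)ᵀ = R⁻¹ := by rw [transpose_nonsing_inv, hR]
  set W := (l.map (coordMatrix H γ)).prod with hW
  set W' := (l.reverse.map (coordMatrix H γ)).prod with hW'
  have hT : sweepMatrix H γ l = W * W' := by simp [sweepMatrix, hW, hW']
  set Q := R * W' * R⁻¹ with hQ
  have hQt : Qᵀ = R * W * R⁻¹ := by
    have h1 : H * W = W'ᵀ * H := mul_listProd hHt γ l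
    rw [hQ, transpose_mul, transpose_mul, hR, hRit]
    calc R⁻¹ * (W'ᵀ * R) = R⁻¹ * (W'ᵀ * (R * R)) * R⁻¹ := by
          rw [mul_assoc, mul_assoc, mul_assoc, hRi, mul_one]
      _ = R⁻¹ * (R * R * W) * R⁻¹ := by rw [hRR, ← h1]
      _ = R * W * R⁻¹ := by
          rw [mul_assoc R R W, ← mul_assoc R⁻¹ R, hiR, one_mul]
  have hQQ : Qᵀ * Q = R * sweepMatrix H γ l * R⁻¹ := by
    rw [hQt, hQ, hT]
    calc R * W * R⁻¹ * (R * W' * R⁻¹) = R * W * (R⁻¹ * R) * W' * R⁻¹ := by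
          simp only [mul_assoc]
      _ = R * (W * W') * R⁻¹ := by rw [hiR]; simp only [mul_assoc, one_mul]
  have hpsd : (Qᵀ * Q).PosSemidef := by
    have := posSemidef_conjTranspose_mul_self Q
    rwa [conjTranspose_eq_transpose_of_trivial] at this
  have hquad : ∀ x, (R *ᵥ x) ⬝ᵥ (R *ᵥ x) = x ⬝ᵥ H *ᵥ x := by
    intro x
    rw [dotProduct_mulVec, ← mulVec_transpose, hR, mulVec_mulVec, hRR, dotProduct_comm]
  have hlt : ∀ x, x ≠ 0 → (Q *ᵥ x) ⬝ᵥ (Q *ᵥ x) < x ⬝ᵥ x := by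
    intro x hx
    set y := R⁻¹ *ᵥ x with hy
    have hRy : R *ᵥ y = x := by rw [hy, mulVec_mulVec, hRi, one_mulVec]
    have hQx : Q *ᵥ x = R *ᵥ (W' *ᵥ y) := by rw [hQ, ← mulVec_mulVec, ← mulVec_mulVec]
    rw [hQx, ← hRy, hquad, hquad]
    rcases energy_sweep hH hγ l y with h | ⟨h, -⟩
    · exact h
    · have h0 : H *ᵥ y = 0 := funext fun j => h j (hl j)
      have h1 : x ⬝ᵥ x = 0 := by rw [← hRy, hquad, h0, dotProduct_zero]
      exact absurd (dotProduct_self_eq_zero.1 h1) hx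
  set V : Matrix n n ℝ := (hpsd.1.eigenvectorUnitary : Matrix n n ℝ)
  have hVV : star V * V = 1 := Unitary.coe_star_mul_self _
  have hVV' : V * star V = 1 := Unitary.coe_mul_star_self _
  have hspec : Qᵀ * Q = V * diagonal hpsd.1.eigenvalues * star V := by
    have := hpsd.1.spectral_theorem
    rw [Unitary.conjStarAlgAut_apply] at this
    simpa using this
  refine ⟨R⁻¹ * V, star V * R, hpsd.1.eigenvalues, ?_, ?_, ?_, fun i => ⟨?_, ?_⟩, ?_⟩
  · rw [mul_assoc, ← mul_assoc V, hVV', one_mul, hiR]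
  · rw [mul_assoc, ← mul_assoc R, hRi, one_mul, hVV]
  · calc sweepMatrix H γ l = R⁻¹ * (R * sweepMatrix H γ l * R⁻¹) * R := by
          rw [mul_assoc R, ← mul_assoc R⁻¹, hiR, one_mul, mul_assoc, hiR, mul_one]
      _ = R⁻¹ * (Qᵀ * Q) * R := by rw [hQQ]
      _ = _ := (congrArg (R⁻¹ * · * R) hspec).trans (by simp only [mul_assoc])
  · exact hpsd.eigenvalues_nonneg i
  · set v : n → ℝ := ⇑(hpsd.1.eigenvectorBasis i) with hv
    have hv1 : v ⬝ᵥ v = 1 := by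
      have := hpsd.1.eigenvectorBasis.orthonormal.1 i
      rw [EuclideanSpace.norm_eq, Real.sqrt_eq_one] at this
      simpa [dotProduct, ← sq] using this
    have hv0 : v ≠ 0 := by
      intro h
      rw [h] at hv1
      simp at hv1
    have h1 := hlt v hv0
    have h2 : (Q *ᵥ v) ⬝ᵥ (Q *ᵥ v) = hpsd.1.eigenvalues i := by
      have h3 : (Q *ᵥ v) ⬝ᵥ (Q *ᵥ v) = v ⬝ᵥ (Qᵀ * Q) *ᵥ v := by
        rw [← mulVec_mulVec v Qᵀ Q, dotProduct_mulVec v, vecMul_transpose]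
      rw [h3, hpsd.1.mulVec_eigenvectorBasis i, ← hv, dotProduct_smul, hv1, smul_eq_mul, mul_one]
    rw [h2, hv1] at h1
    exact h1
  · rw [← norm_sqrt_mul_norm_inv hR hRR]
    have hVn : ‖V‖ ≤ 1 := by
      have h : ‖V‖ * ‖V‖ ≤ 1 := by
        rw [← l2_opNorm_conjTranspose_mul_self, ← star_eq_conjTranspose, hVV,
          ← diagonal_one, l2_opNorm_diagonal]
        exact (pi_norm_le_iff_of_nonneg zero_le_one).2 fun i => by simp
      nlinarith [norm_nonneg V]
    have hVn' : ‖star V‖ ≤ 1 := by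
      rwa [star_eq_conjTranspose, l2_opNorm_conjTranspose]
    calc ‖R⁻¹ * V‖ * ‖star V * R‖ ≤ (‖R⁻¹‖ * 1) * (1 * ‖R‖) := by
          gcongr
          · exact (l2_opNorm_mul _ _).trans (by gcongr)
          · exact (l2_opNorm_mul _ _).trans (by gcongr)
      _ = ‖R⁻¹‖ * ‖R‖ := by ring

theorem aeval_diagonalization {X Y : Matrix n n ℝ} (hXY : X * Y = 1) (hYX : Y * X = 1)
    (d : n → ℝ) (F : ℝ[X]) :
    aeval (X * diagonal d * Y) F = X * diagonal (fun i => F.eval (d i)) * Y := by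
  induction F using Polynomial.induction_on' with
  | add p q hp hq =>
    rw [map_add, hp, hq, ← add_mul, ← mul_add, diagonal_add]
    simp
  | monomial k a =>
    have hpow : (X * diagonal d * Y) ^ k = X * diagonal (d ^ k) * Y := by
      induction k with
      | zero =>
        rw [pow_zero, pow_zero]
        change 1 = X * diagonal (fun _ => 1) * Y
        rw [diagonal_one, mul_one, hXY]
      | succ k ih =>
        rw [pow_succ, ih, pow_succ,
          show diagonal (d ^ k * d) = diagonal (d ^ k) * diagonal d from
            (diagonal_mul_diagonal (d ^ k) d).symm]
        calc X * diagonal (d ^ k) * Y * (X * diagonal d * Y)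
            = X * diagonal (d ^ k) * (Y * X) * diagonal d * Y := by simp only [mul_assoc]
          _ = _ := by rw [hYX]; simp only [mul_assoc, mul_one]
    rw [aeval_monomial, hpow, Algebra.algebraMap_eq_smul_one, smul_one_mul, ← smul_mul_assoc,
      ← mul_smul_comm, ← diagonal_smul]
    congr
    ext i
    simp

/-- The spectral data of a symmetric sweep: its spectral radius is less than one, and a polynomial
in the sweep is bounded by its values on `[0, ρ]`, up to the factor `√κ(H)`. -/
theorem sweepMatrix_spectral {H : Matrix n n ℝ} (hH : H.PosDef) {γ : n → ℝ}
    (hγ : ∀ j, H j j ≤ γ j) {l : List n} (hl : ∀ j, j ∈ l) :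
    specRadius (sweepMatrix H γ l) < 1 ∧
    ∀ (F : ℝ[X]) (c : ℝ), 0 ≤ c →
      (∀ x ∈ Set.Icc 0 (specRadius (sweepMatrix H γ l)), |F.eval x| ≤ c) → ∀ v : n → ℝ,
      ‖(WithLp.toLp 2 (aeval (sweepMatrix H γ l) F *ᵥ v) : EuclideanSpace ℝ n)‖ ≤
        √(condNumber H) * c * ‖(WithLp.toLp 2 v : EuclideanSpace ℝ n)‖ := by
  obtain ⟨X, Y, d, hXY, hYX, hT, hd, hn⟩ := exists_diagonalization hH hγ hl
  rw [hT]
  set φ := algebraMap ℝ ℂ with hφ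
  have hmap : ((X * diagonal d * Y).map φ) =
      X.map φ * diagonal (fun i => φ (d i)) * Y.map φ := by
    rw [Matrix.map_mul, Matrix.map_mul, diagonal_map (map_zero φ)]
  have hXYc : X.map φ * Y.map φ = 1 := by
    rw [← Matrix.map_mul, hXY, Matrix.map_one _ (map_zero φ) (map_one φ)]
  have hYXc : Y.map φ * X.map φ = 1 := by
    rw [← Matrix.map_mul, hYX, Matrix.map_one _ (map_zero φ) (map_one φ)]
  have hspec : spectrum ℂ ((X * diagonal d * Y).map φ) = Set.range fun i => φ (d i) := by
    let u : (Matrix n n ℂ)ˣ := ⟨X.map φ, Y.map φ, hXYc, hYXc⟩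
    rw [hmap, ← spectrum_diagonal]
    exact spectrum.units_conjugate (u := u)
  have hrad : spectralRadius ℂ ((X * diagonal d * Y).map φ) = ⨆ i, (‖d i‖₊ : ENNReal) := by
    rw [spectralRadius, hspec, iSup_range]
    simp [hφ]
  have hfin : spectralRadius ℂ ((X * diagonal d * Y).map φ) < 1 := by
    rw [hrad, ← Finset.sup_univ_eq_iSup, Finset.sup_lt_iff (by simp)]
    intro i _
    rw [← ENNReal.coe_one, ENNReal.coe_lt_coe, ← NNReal.coe_lt_coe, coe_nnnorm, Real.norm_eq_abs,
      abs_of_nonneg (hd i).1]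
    exact (hd i).2
  have hlt : specRadius (X * diagonal d * Y) < 1 := by
    rw [specRadius, ← ENNReal.toReal_one]
    exact (ENNReal.toReal_lt_toReal (hfin.trans ENNReal.one_lt_top).ne ENNReal.one_ne_top).2 hfin
  have hle : ∀ i, d i ≤ specRadius (X * diagonal d * Y) := by
    intro i
    have h1 : (‖d i‖₊ : ENNReal) ≤ spectralRadius ℂ ((X * diagonal d * Y).map φ) := by
      rw [hrad]
      exact le_iSup (fun i => (‖d i‖₊ : ENNReal)) i
    have h2 := ENNReal.toReal_mono (hfin.trans ENNReal.one_lt_top).ne h1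
    exact (le_abs_self _).trans h2
  refine ⟨hlt, fun F c hc hF v => ?_⟩
  rw [aeval_diagonalization hXY hYX]
  refine (norm_mulVec_le _ _).trans ?_
  gcongr
  have hdiag : ‖(diagonal (fun i => F.eval (d i)) : Matrix n n ℝ)‖ ≤ c := by
    rw [l2_opNorm_diagonal]
    exact (pi_norm_le_iff_of_nonneg hc).2 fun i => hF _ ⟨(hd i).1, hle i⟩
  calc ‖X * diagonal (fun i => F.eval (d i)) * Y‖
      ≤ ‖X‖ * ‖(diagonal (fun i => F.eval (d i)) : Matrix n n ℝ)‖ * ‖Y‖ :=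
        (l2_opNorm_mul _ _).trans (by gcongr; exact l2_opNorm_mul _ _)
    _ ≤ ‖X‖ * c * ‖Y‖ := by gcongr
    _ = ‖X‖ * ‖Y‖ * c := by ring
    _ ≤ √(condNumber H) * c := by gcongr

end Sweep

/-! ### Decay of the residuals -/

/-- A nonnegative sequence that tends to zero has arbitrarily late terms that bound all the following
ones: the largest term beyond `k0` is such a term. -/
theorem exists_forall_le_of_tendsto_zero {y : ℕ → ℝ} (hy : ∀ k, 0 ≤ y k)
    (hlim : Tendsto y atTop (𝓝 0)) (k0 : ℕ) : ∃ K, k0 ≤ K ∧ ∀ k, K ≤ k → y k ≤ y K := by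
  by_cases h : ∀ k, k0 ≤ k → y k = 0
  · exact ⟨k0, le_rfl, fun k hk => by rw [h k hk, h k0 le_rfl]⟩
  · push Not at h
    obtain ⟨k1, hk1, hne⟩ := h
    have hpos : 0 < y k1 := lt_of_le_of_ne (hy k1) (Ne.symm hne)
    obtain ⟨N, hN⟩ := eventually_atTop.1 (hlim.eventually_lt_const hpos)
    obtain ⟨K, hK, hmax⟩ := Finset.exists_max_image (Finset.Icc k0 (max N k1)) y
      ⟨k1, Finset.mem_Icc.2 ⟨hk1, le_max_right _ _⟩⟩
    rw [Finset.mem_Icc] at hK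
    refine ⟨K, hK.1, fun k hk => ?_⟩
    rcases le_or_gt k (max N k1) with h1 | h1
    · exact hmax k (Finset.mem_Icc.2 ⟨hK.1.trans hk, h1⟩)
    · exact (hN k ((le_max_left _ _).trans h1.le)).le.trans
        (hmax k1 (Finset.mem_Icc.2 ⟨hk1, le_max_right _ _⟩))

/-- A sequence that decays at a rate `s < r` per `M` terms satisfies, from some index `K` on, the
bound at the rate `r` with constant one: `K` is a maximizer of `‖w k‖ / r ^ (k / M)`. -/
theorem exists_rate_index {y : ℕ → ℝ} (hy : ∀ k, 0 ≤ y k) {M : ℕ} (hM : 0 < M) {r s C : ℝ}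
    (hs : 0 ≤ s) (hsr : s < r) (m : ℕ)
    (hdecay : ∀ t i, i < M → y (M * (m + t) + i) ≤ C * s ^ t) (k0 : ℕ) :
    ∃ K, k0 ≤ K ∧ ∀ k, K ≤ k → y k ≤ r ^ (((k : ℝ) - K) / M) * y K := by
  have hr : 0 < r := hs.trans_lt hsr
  have hMr : (0 : ℝ) < M := by exact_mod_cast hM
  set q : ℝ := r ^ ((M : ℝ)⁻¹) with hq
  have hq0 : 0 < q := Real.rpow_pos_of_pos hr _
  have hqM : q ^ M = r := Real.rpow_inv_natCast_pow hr.le hM.ne'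
  have hC : 0 ≤ C := by
    have := (hy _).trans (hdecay 0 0 hM)
    simpa using this
  set b := min 1 q with hb
  have hb0 : 0 < b := lt_min one_pos hq0
  have hlim : Tendsto (fun k => y k / q ^ k) atTop (𝓝 0) := by
    have h1 : Tendsto (fun k : ℕ => C / (r ^ m * b ^ M) * (s / r) ^ (k / M - m)) atTop (𝓝 0) := by
      rw [← mul_zero (C / (r ^ m * b ^ M))]
      refine Tendsto.const_mul _ ?_
      exact (tendsto_pow_atTop_nhds_zero_of_lt_one (by positivity) ((div_lt_one hr).2 hsr)).comp
        ((tendsto_sub_atTop_nat m).comp (Nat.tendsto_div_const_atTop hM.ne'))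
    refine squeeze_zero' (Eventually.of_forall fun k => div_nonneg (hy k) (by positivity)) ?_ h1
    filter_upwards [eventually_ge_atTop (M * m)] with k hk
    have hmk : m ≤ k / M := (Nat.le_div_iff_mul_le hM).2 (by rwa [mul_comm])
    set t := k / M - m with ht
    have hk2 : k = M * (m + t) + k % M := by
      rw [ht, Nat.add_sub_cancel' hmk, Nat.div_add_mod]
    have hi : k % M < M := Nat.mod_lt _ hM
    have h2 : y k ≤ C * s ^ t := by
      rw [hk2]
      exact hdecay t _ hi
    have h3 : b ^ M ≤ q ^ (k % M) :=
      (pow_le_pow_of_le_one hb0.le (min_le_left _ _) hi.le).trans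
        (pow_le_pow_left₀ hb0.le (min_le_right _ _) _)
    have h4 : q ^ k = r ^ m * r ^ t * q ^ (k % M) := by
      conv_lhs => rw [hk2]
      rw [pow_add, pow_mul, hqM, pow_add]
    rw [h4]
    calc y k / (r ^ m * r ^ t * q ^ (k % M)) ≤ C * s ^ t / (r ^ m * r ^ t * b ^ M) := by gcongr
      _ = C / (r ^ m * b ^ M) * (s / r) ^ t := by
        rw [div_pow]
        field_simp
  obtain ⟨K, hK, hmax⟩ := exists_forall_le_of_tendsto_zero
    (fun k => div_nonneg (hy k) (pow_nonneg hq0.le k)) hlim k0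
  refine ⟨K, hK, fun k hk => ?_⟩
  have h1 := hmax k hk
  rw [div_le_div_iff₀ (by positivity) (by positivity)] at h1
  have h2 : r ^ (((k : ℝ) - K) / M) = q ^ k / q ^ K := by
    rw [hq, ← Real.rpow_natCast, ← Real.rpow_natCast, ← Real.rpow_mul hr.le, ← Real.rpow_mul hr.le,
      ← Real.rpow_sub hr]
    congr 1
    field_simp
  rw [h2, div_mul_eq_mul_div, le_div_iff₀ (by positivity)]
  linarith

/-- Residuals of Anderson acceleration, for a linear iteration `T` whose polynomials are controlled
on `[0, ρ]`. Each cycle of `M` steps either applies `T ^ M` or the minimal polynomial residual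
followed by one step of `T`. The factor `κ` that compares the norms is paid at the accepted
extrapolations only: the rejected cycles that precede an acceptance are estimated together with
it, and the final step of `T` gains a further factor `ρ`. -/
theorem residual_decay {n : Type*} [Fintype n] [DecidableEq n] {T : Matrix n n ℝ} {ρ κ : ℝ}
    (hρ0 : 0 < ρ) (hρ1 : ρ < 1) (hκ : 0 ≤ κ)
    (hpoly : ∀ (F : ℝ[X]) (c : ℝ), 0 ≤ c → (∀ x ∈ Set.Icc 0 ρ, |F.eval x| ≤ c) → ∀ v : n → ℝ,
      ‖(WithLp.toLp 2 (aeval T F *ᵥ v) : EuclideanSpace ℝ n)‖ ≤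
        κ * c * ‖(WithLp.toLp 2 v : EuclideanSpace ℝ n)‖)
    {M : ℕ} (hM : 0 < M) {s : ℝ} (hs : 0 ≤ s)
    (hrs : ρ * (κ * (2 * zeta ρ ^ (M - 1) / (1 + zeta ρ ^ (2 * (M - 1))))) ≤ s)
    (w : ℕ → n → ℝ) (k0 : ℕ) (hstep : ∀ k, k0 ≤ k → ¬ M ∣ k + 1 → w (k + 1) = T *ᵥ w k)
    (hcyc : ∀ k, k0 + M ≤ k + 1 → M ∣ k + 1 → (w (k + 1) = T *ᵥ w k ∧ ρ ^ M ≤ s) ∨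
      ∃ v, w (k + 1) = T *ᵥ v ∧ ∀ F : ℝ[X], F.natDegree ≤ M - 1 → F.eval 1 = 1 →
        ‖(WithLp.toLp 2 v : EuclideanSpace ℝ n)‖ ≤
          ‖(WithLp.toLp 2 (aeval T F *ᵥ w (k + 1 - M)) : EuclideanSpace ℝ n)‖) :
    ∃ C, ∀ t i, i < M →
      ‖(WithLp.toLp 2 (w (M * (k0 + 1 + t) + i)) : EuclideanSpace ℝ n)‖ ≤ C * s ^ t := by
  set τ := 2 * zeta ρ ^ (M - 1) / (1 + zeta ρ ^ (2 * (M - 1))) with hτ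
  have hz := zeta_pos hρ0
  have hτ0 : 0 ≤ τ := by positivity
  obtain ⟨P, hPdeg, hP1, hPb⟩ := exists_chebyshev_poly (M - 1) hρ0 hρ1
  have hk0 : ∀ m, k0 + 1 ≤ m → k0 + M ≤ M * m := by
    intro m hm
    have : M * (k0 + 1) ≤ M * m := Nat.mul_le_mul_left M hm
    nlinarith [Nat.mul_le_mul_right k0 hM]
  have hin : ∀ m, k0 + 1 ≤ m → ∀ i, i < M → w (M * m + i) = T ^ i *ᵥ w (M * m) := by
    intro m hm i
    induction i with
    | zero => simp
    | succ i ih =>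
      intro hi
      have hnd : ¬ M ∣ M * m + i + 1 := by
        rw [add_assoc, Nat.dvd_add_right (dvd_mul_right M m)]
        exact fun h => absurd (Nat.le_of_dvd (Nat.succ_pos i) h) (by omega)
      rw [← add_assoc, hstep _ (by have := hk0 m hm; omega) hnd, ih (by omega), mulVec_mulVec,
        ← pow_succ']
  have hlast : ∀ m, k0 + 1 ≤ m → ∃ k, k + 1 = M * (m + 1) ∧ w k = T ^ (M - 1) *ᵥ w (M * m) := by
    intro m hm
    refine ⟨M * m + (M - 1), ?_, hin m hm _ (by omega)⟩
    rw [mul_add]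
    omega
  have hpow : ∀ j v, ‖(WithLp.toLp 2 (T ^ j *ᵥ v) : EuclideanSpace ℝ n)‖ ≤
      κ * ρ ^ j * ‖(WithLp.toLp 2 v : EuclideanSpace ℝ n)‖ := by
    intro j v
    have := hpoly (X ^ j) (ρ ^ j) (by positivity) (fun x hx => by
      rw [eval_pow, eval_X, abs_pow, abs_of_nonneg hx.1]
      exact pow_le_pow_left₀ hx.1 hx.2 j) v
    simpa using this
  -- The first residual is in the range of `T`, whatever the choice made at that step.
  obtain ⟨v0, hv0⟩ : ∃ v0, w (M * (k0 + 1)) = T *ᵥ v0 := by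
    obtain ⟨k, hk⟩ : ∃ k, k + 1 = M * (k0 + 1) :=
      ⟨M * (k0 + 1) - 1, Nat.succ_pred_eq_of_pos (Nat.mul_pos hM (Nat.succ_pos _))⟩
    rw [← hk]
    rcases hcyc k (by rw [hk]; exact hk0 _ le_rfl) (by rw [hk]; exact dvd_mul_right _ _)
      with h | ⟨v, h, -⟩
    · exact ⟨_, h.1⟩
    · exact ⟨_, h⟩
  set C := ‖(WithLp.toLp 2 v0 : EuclideanSpace ℝ n)‖ with hC
  have hinv : ∀ t, ∃ v a b, a + b = t ∧ w (M * (k0 + 1 + t)) = T ^ (1 + a * M) *ᵥ v ∧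
      ‖(WithLp.toLp 2 v : EuclideanSpace ℝ n)‖ ≤ C * s ^ b ∧ (a = 0 ∨ ρ ^ M ≤ s) := by
    intro t
    induction t with
    | zero => exact ⟨v0, 0, 0, rfl, by simpa using hv0, by simp [hC], Or.inl rfl⟩
    | succ t ih =>
      obtain ⟨v, a, b, hab, hw, hv, ha⟩ := ih
      obtain ⟨k, hk, hwk⟩ := hlast (k0 + 1 + t) (by omega)
      rw [← add_assoc, ← hk]
      rcases hcyc k (by rw [hk]; exact hk0 _ (by omega)) (by rw [hk]; exact dvd_mul_right _ _)
        with ⟨h, hρs⟩ | ⟨v', h, hmin⟩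
      · refine ⟨v, a + 1, b, by omega, ?_, hv, Or.inr hρs⟩
        rw [h, hwk, hw, mulVec_mulVec, mulVec_mulVec, ← pow_succ', ← pow_add]
        congr 2
        rw [add_mul]
        omega
      · refine ⟨v', 0, t + 1, by omega, by simpa using h, ?_, Or.inl rfl⟩
        have hkM : k + 1 - M = M * (k0 + 1 + t) := by
          rw [hk, mul_add M _ 1, mul_one, Nat.add_sub_cancel]
        have h1 := hmin P hPdeg hP1
        rw [hkM, hw, mulVec_mulVec] at h1
        have h2 := hpoly (P * X ^ (1 + a * M)) (τ * ρ ^ (1 + a * M)) (by positivity) (fun x hx => by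
          rw [eval_mul, eval_pow, eval_X, abs_mul, abs_pow, abs_of_nonneg hx.1]
          exact mul_le_mul (hPb x hx) (pow_le_pow_left₀ hx.1 hx.2 _) (pow_nonneg hx.1 _) hτ0) v
        rw [map_mul, map_pow, aeval_X] at h2
        have h3 : (ρ ^ M) ^ a ≤ s ^ a := by
          rcases ha with rfl | ha
          · simp
          · exact pow_le_pow_left₀ (by positivity) ha a
        calc ‖(WithLp.toLp 2 v' : EuclideanSpace ℝ n)‖
            ≤ κ * (τ * ρ ^ (1 + a * M)) * ‖(WithLp.toLp 2 v : EuclideanSpace ℝ n)‖ := h1.trans h2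
          _ = (ρ * (κ * τ)) * (ρ ^ M) ^ a * ‖(WithLp.toLp 2 v : EuclideanSpace ℝ n)‖ := by
            rw [← pow_mul]
            ring
          _ ≤ s * s ^ a * (C * s ^ b) := by gcongr
          _ = C * s ^ (t + 1) := by
            rw [← hab]
            ring
  refine ⟨κ * C, fun t i hi => ?_⟩
  obtain ⟨v, a, b, hab, hw, hv, ha⟩ := hinv t
  rw [hin _ (by omega) i hi, hw, mulVec_mulVec, ← pow_add]
  have h3 : (ρ ^ M) ^ a ≤ s ^ a := by
    rcases ha with rfl | ha
    · simp
    · exact pow_le_pow_left₀ (by positivity) ha a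
  have h4 : ρ ^ (i + (1 + a * M)) ≤ (ρ ^ M) ^ a := by
    rw [← pow_mul]
    exact pow_le_pow_of_le_one hρ0.le hρ1.le (by rw [mul_comm M a]; omega)
  calc _ ≤ κ * ρ ^ (i + (1 + a * M)) * ‖(WithLp.toLp 2 v : EuclideanSpace ℝ n)‖ := hpow _ _
    _ ≤ κ * s ^ a * (C * s ^ b) := by
      have := h4.trans h3
      gcongr
    _ = κ * C * s ^ t := by
      rw [← hab]
      ring

/-! ### Piecewise quadratic functions are quadratic where they are smooth -/

theorem IsPolyhedral.isClosed {E : Type*} [NormedAddCommGroup E] [NormedSpace ℝ E]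
    [FiniteDimensional ℝ E] {C : Set E} (hC : IsPolyhedral C) : IsClosed C := by
  obtain ⟨m, a, b, rfl⟩ := hC
  rw [Set.ofPred_forall]
  exact isClosed_iInter fun i =>
    isClosed_le (a i).continuous_of_finiteDimensional continuous_const

/-- The second derivative of a polynomial of degree at most two is constant. -/
theorem exists_second_fderiv_eq {E : Type*} [NormedAddCommGroup E] [NormedSpace ℝ E]
    [FiniteDimensional ℝ E] {h : E → ℝ} {U : Set E} (hU : IsOpen U) (Q : QuadraticForm ℝ E)
    (l : E →ₗ[ℝ] ℝ) (c : ℝ) (hq : ∀ x ∈ U, h x = Q x + l x + c) :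
    ∃ G, ∀ x ∈ U, fderiv ℝ (fderiv ℝ h) x = G := by
  let b : E →L[ℝ] E →L[ℝ] ℝ := LinearMap.toContinuousLinearMap
    ((LinearMap.toContinuousLinearMap : (E →ₗ[ℝ] ℝ) ≃ₗ[ℝ] (E →L[ℝ] ℝ)).toLinearMap ∘ₗ
      QuadraticMap.associated (R := ℝ) Q)
  let lc : E →L[ℝ] ℝ := LinearMap.toContinuousLinearMap l
  have hb : ∀ x, b x x = Q x := fun x => QuadraticMap.associated_eq_self_apply ℝ Q x
  have h1 : ∀ x ∈ U, fderiv ℝ h x = (b + b.flip) x + lc := by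
    intro x hx
    have hder : HasFDerivAt (fun x => b x x + lc x + c) ((b + b.flip) x + lc) x := by
      have h2 := ((b.hasFDerivAt (x := x)).clm_apply (hasFDerivAt_id x)).add (lc.hasFDerivAt (x := x))
      have h3 := h2.add_const c
      refine h3.congr_fderiv ?_
      ext v
      simp
    refine (hder.congr_of_eventuallyEq ?_).fderiv
    filter_upwards [hU.mem_nhds hx] with y hy
    rw [hq y hy, hb]
    rfl
  refine ⟨b + b.flip, fun x hx => ?_⟩
  have h2 : HasFDerivAt (fun x => (b + b.flip) x + lc) (b + b.flip) x :=
    (b + b.flip).hasFDerivAt.add_const lc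
  refine (h2.congr_of_eventuallyEq ?_).fderiv
  filter_upwards [hU.mem_nhds hx] with y hy using h1 y hy

/-- Near a point where it is `C²`, a piecewise quadratic function has an affine derivative: its
second derivative is continuous there, and on a dense set it takes finitely many values. -/
theorem eventually_fderiv_affine {E : Type*} [NormedAddCommGroup E] [NormedSpace ℝ E]
    [FiniteDimensional ℝ E] {h : E → ℝ} {x0 : E} (hC2 : ContDiffAt ℝ 2 h x0) {N : ℕ}
    (C : Fin N → Set E) (hclosed : ∀ i, IsClosed (C i)) (hcov : ∀ᶠ x in 𝓝 x0, x ∈ ⋃ i, C i)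
    (hquad : ∀ i, ∃ (Q : QuadraticForm ℝ E) (l : E →ₗ[ℝ] ℝ) (c : ℝ),
      ∀ x ∈ C i, h x = Q x + l x + c) :
    ∀ᶠ x in 𝓝 x0, fderiv ℝ h x = fderiv ℝ h x0 + fderiv ℝ (fderiv ℝ h) x0 (x - x0) := by
  have hev := (hC2.eventually (by simp)).and hcov
  obtain ⟨δ, hδ, hball⟩ := Metric.eventually_nhds_iff_ball.1 hev
  set W := Metric.ball x0 δ with hW
  have hWo : IsOpen W := Metric.isOpen_ball
  have hWc : IsPreconnected W := (convex_ball x0 δ).isPreconnected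
  have hx0 : x0 ∈ W := Metric.mem_ball_self hδ
  have hD1 : ∀ x ∈ W, ContDiffAt ℝ 1 (fderiv ℝ h) x := fun x hx =>
    (hball x hx).1.fderiv_right (by norm_num)
  have hD2 : ContinuousOn (fderiv ℝ (fderiv ℝ h)) W := fun x hx =>
    ((hD1 x hx).fderiv_right (m := 0) (by norm_num)).continuousAt.continuousWithinAt
  have hG : ∀ i, ∃ G, ∀ x ∈ interior (C i), fderiv ℝ (fderiv ℝ h) x = G := fun i => by
    obtain ⟨Q, l, c, hq⟩ := hquad i
    exact exists_second_fderiv_eq isOpen_interior Q l c fun x hx => hq x (interior_subset hx)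
  choose G hG using hG
  have hfin : (Set.range G).Finite := Set.finite_range G
  have hmaps : ∀ x ∈ W, fderiv ℝ (fderiv ℝ h) x ∈ Set.range G := by
    by_contra! hcon
    obtain ⟨x, hx, hxG⟩ := hcon
    have hopen : IsOpen (W ∩ fderiv ℝ (fderiv ℝ h) ⁻¹' (Set.range G)ᶜ) :=
      hD2.isOpen_inter_preimage hWo hfin.isClosed.isOpen_compl
    -- The pieces, together with the complement of the ball, form a closed cover of the space.
    let C' : Option (Fin N) → Set E := fun o => o.elim Wᶜ C
    have hC' : ∀ o, IsClosed (C' o) := by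
      rintro (_ | i)
      · exact hWo.isClosed_compl
      · exact hclosed i
    have hcover : ⋃ o, C' o = Set.univ := by
      rw [Set.eq_univ_iff_forall]
      intro y
      by_cases hy : y ∈ W
      · obtain ⟨i, hi⟩ := Set.mem_iUnion.1 (hball y hy).2
        exact Set.mem_iUnion.2 ⟨some i, hi⟩
      · exact Set.mem_iUnion.2 ⟨none, hy⟩
    obtain ⟨y, ⟨hyW, hyG⟩, hy⟩ :=
      (dense_iUnion_interior_of_closed hC' hcover).inter_open_nonempty _ hopen ⟨x, hx, hxG⟩
    obtain ⟨o, ho⟩ := Set.mem_iUnion.1 hy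
    rcases o with _ | i
    · exact interior_subset ho hyW
    · exact hyG ⟨i, (hG i y ho).symm⟩
  have hconst : ∀ x ∈ W, fderiv ℝ (fderiv ℝ h) x = fderiv ℝ (fderiv ℝ h) x0 := by
    intro x hx
    refine hfin.countable.isTotallyDisconnected (fderiv ℝ (fderiv ℝ h) '' W) ?_ (hWc.image _ hD2)
      ⟨x, hx, rfl⟩ ⟨x0, hx0, rfl⟩
    rintro _ ⟨y, hy, rfl⟩
    exact hmaps y hy
  have hder : ∀ x ∈ W, HasFDerivAt
      (fun x => fderiv ℝ h x - fderiv ℝ (fderiv ℝ h) x0 x) (0 : E →L[ℝ] E →L[ℝ] ℝ) x := by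
    intro x hx
    have h1 := ((hD1 x hx).differentiableAt (by norm_num)).hasFDerivAt
    rw [hconst x hx] at h1
    exact (h1.sub (fderiv ℝ (fderiv ℝ h) x0).hasFDerivAt).congr_fderiv (sub_self _)
  filter_upwards [hWo.mem_nhds hx0] with x hx
  have h1 := hWo.is_const_of_fderiv_eq_zero hWc
    (fun y hy => (hder y hy).differentiableAt.differentiableWithinAt)
    (fun y hy => (hder y hy).fderiv) hx hx0
  rw [map_sub, add_sub_left_comm, ← h1]
  abel

theorem partialDeriv_eventually_affine {p : ℕ} {f : (Fin p → ℝ) → ℝ} {x0 : Fin p → ℝ}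
    (hq : PiecewiseQuadratic (fun x => (f x : EReal))) (hC2 : ContDiffAt ℝ 2 f x0) (j : Fin p) :
    ∀ᶠ x in 𝓝 x0, partialDeriv f j x = partialDeriv f j x0 +
      ∑ i, (x i - x0 i) * partialDeriv (partialDeriv f j) i x0 := by
  obtain ⟨N, C, hC, hdom, hquad⟩ := hq
  have haff := eventually_fderiv_affine hC2 C (fun i => (hC i).isClosed)
    (Eventually.of_forall fun x => by rw [← hdom]; exact EReal.coe_ne_top _)
    (fun i => by
      obtain ⟨Q, l, c, h⟩ := hquad i
      exact ⟨Q, l, c, fun x hx => EReal.coe_injective (h x hx)⟩)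
  set G := fderiv ℝ (fderiv ℝ f) x0 with hG
  have h1 : ∀ᶠ x in 𝓝 x0,
      partialDeriv f j x = partialDeriv f j x0 + G (x - x0) (Pi.single j 1) := by
    filter_upwards [haff] with x hx
    rw [partialDeriv, hx]
    rfl
  have h2 : ∀ i, partialDeriv (partialDeriv f j) i x0 = G (Pi.single i 1) (Pi.single j 1) := by
    intro i
    have h3 : HasFDerivAt (fun x => partialDeriv f j x0 + G (x - x0) (Pi.single j 1))
        (G.flip (Pi.single j 1)) x0 := by
      have := ((G.flip (Pi.single j 1)).hasFDerivAt.comp x0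
        ((hasFDerivAt_id x0).sub_const x0)).const_add (partialDeriv f j x0)
      exact this
    rw [partialDeriv, (h3.congr_of_eventuallyEq h1).fderiv]
    rfl
  filter_upwards [h1] with x hx
  rw [hx]
  congr 1
  have h4 : x - x0 = ∑ i, (x i - x0 i) • (Pi.single i 1 : Fin p → ℝ) := by
    ext k
    simp [Finset.sum_apply, Pi.single_apply]
  conv_lhs => rw [h4]
  simp only [map_sum, map_smul, _root_.sum_apply, _root_.smul_apply,
    smul_eq_mul, h2]

theorem deriv_eventually_affine {g : ℝ → EReal} {x0 : ℝ} (hq : PiecewiseQuadratic g)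
    (hfin : ∀ᶠ x in 𝓝 x0, g x ≠ ⊤) (hC2 : ContDiffAt ℝ 2 (fun x => (g x).toReal) x0) :
    ∀ᶠ x in 𝓝 x0, deriv (fun x => (g x).toReal) x = deriv (fun x => (g x).toReal) x0 +
      iteratedDeriv 2 (fun x => (g x).toReal) x0 * (x - x0) := by
  obtain ⟨N, C, hC, hdom, hquad⟩ := hq
  set h := fun x => (g x).toReal with hh
  have haff := eventually_fderiv_affine hC2 C (fun i => (hC i).isClosed)
    (hfin.mono fun x hx => by rw [← hdom]; exact hx)
    (fun i => by
      obtain ⟨Q, l, c, h⟩ := hquad i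
      exact ⟨Q, l, c, fun x hx => by rw [hh]; simp only [h x hx, EReal.toReal_coe]⟩)
  set G := fderiv ℝ (fderiv ℝ h) x0 1 1 with hG
  have h1 : ∀ᶠ x in 𝓝 x0, deriv h x = deriv h x0 + G * (x - x0) := by
    filter_upwards [haff] with x hx
    have h2 : fderiv ℝ (fderiv ℝ h) x0 (x - x0) = (x - x0) • fderiv ℝ (fderiv ℝ h) x0 1 := by
      rw [← map_smul, smul_eq_mul, mul_one]
    rw [← fderiv_apply_one_eq_deriv, ← fderiv_apply_one_eq_deriv, hx, h2,
      _root_.add_apply, _root_.smul_apply, smul_eq_mul, mul_comm]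
  have h2 : iteratedDeriv 2 h x0 = G := by
    rw [iteratedDeriv_succ, iteratedDeriv_one,
      Filter.EventuallyEq.deriv_eq (f := fun x => deriv h x0 + G * (x - x0)) h1]
    simp
  rw [h2]
  exact h1

/-! ### Subgradients and proximal operators of semiconvex functions -/

theorem mem_subdiff_iff {h : ℝ → EReal} {u v : ℝ} :
    v ∈ subdiff h u ↔ h u ≠ ⊤ ∧ h u ≠ ⊥ ∧ ∀ ε : ℝ, 0 < ε →
      ∀ᶠ y in 𝓝 u, h u + ((v * (y - u) - ε * |y - u| : ℝ) : EReal) ≤ h y := by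
  have h1 : ∀ y, (v • (1 : ℝ →L[ℝ] ℝ)) (y - u) = v * (y - u) := fun y => rfl
  simp only [subdiff, frechetSubdiff, Set.mem_ofPred_eq, h1, Real.norm_eq_abs]

theorem exists_coe_of_mem_subdiff {h : ℝ → EReal} {u v : ℝ} (hv : v ∈ subdiff h u) :
    ∃ a : ℝ, h u = a := by
  rw [mem_subdiff_iff] at hv
  exact ⟨(h u).toReal, (EReal.coe_toReal hv.1 hv.2.1).symm⟩

theorem div_mem_subdiff {g : ℝ → EReal} {L u v : ℝ} (hL : 0 < L) (hv : v ∈ subdiff g u) :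
    v / L ∈ subdiff (fun x => g x / (L : EReal)) u := by
  obtain ⟨a, ha⟩ := exists_coe_of_mem_subdiff hv
  rw [mem_subdiff_iff] at hv ⊢
  simp only [ha, ← EReal.coe_div]
  refine ⟨EReal.coe_ne_top _, EReal.coe_ne_bot _, fun ε hε => ?_⟩
  filter_upwards [hv.2.2 (ε * L) (by positivity)] with y hy
  rw [ha] at hy
  rw [← EReal.coe_add] at hy ⊢
  have h1 : a / L + (v / L * (y - u) - ε * |y - u|) =
      (a + (v * (y - u) - ε * L * |y - u|)) / L := by
    field_simp
  rw [h1, EReal.coe_div]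
  exact EReal.div_le_div_right_of_nonneg (by exact_mod_cast hL.le) hy

theorem deriv_mem_subdiff {g : ℝ → EReal} {u d : ℝ} (hfin : ∀ᶠ x in 𝓝 u, g x ≠ ⊤ ∧ g x ≠ ⊥)
    (hd : HasDerivAt (fun x => (g x).toReal) d u) : d ∈ subdiff g u := by
  rw [mem_subdiff_iff]
  have hu := hfin.self_of_nhds
  refine ⟨hu.1, hu.2, fun ε hε => ?_⟩
  have h1 := (hasDerivAt_iff_isLittleO.1 hd).def hε
  filter_upwards [h1, hfin] with y hy hfy
  rw [← EReal.coe_toReal hu.1 hu.2, ← EReal.coe_toReal hfy.1 hfy.2, ← EReal.coe_add,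
    EReal.coe_le_coe_iff]
  rw [Real.norm_eq_abs, Real.norm_eq_abs, smul_eq_mul] at hy
  have h2 := (abs_le.1 hy).1
  linarith

/-- A Fréchet subgradient of an `α`-semiconvex function supports it globally, up to the
quadratic term. -/
theorem le_of_mem_subdiff {h : ℝ → EReal} {α u v : ℝ} (hs : SemiConvex α h)
    (hbot : ∀ x, h x ≠ ⊥) (hv : v ∈ subdiff h u) (y : ℝ) :
    h u + ((v * (y - u) - α / 2 * (y - u) ^ 2 : ℝ) : EReal) ≤ h y := by
  obtain ⟨a, ha⟩ := exists_coe_of_mem_subdiff hv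
  rw [mem_subdiff_iff] at hv
  rcases eq_or_ne (h y) ⊤ with hy | hy
  · rw [hy]
    exact le_top
  obtain ⟨b, hb⟩ : ∃ b : ℝ, h y = b := ⟨_, (EReal.coe_toReal hy (hbot y)).symm⟩
  rw [ha, hb, ← EReal.coe_add, EReal.coe_le_coe_iff]
  set d := y - u with hd
  -- The difference quotients along the segment from `u` to `y` are bounded by their value at `y`.
  have hconv : ∀ t : ℝ, 0 ≤ t → t ≤ 1 →
      h (u + t * d) + ((α * (u + t * d) ^ 2 / 2 : ℝ) : EReal) ≤
        (((1 - t) * (a + α * u ^ 2 / 2) + t * (b + α * y ^ 2 / 2) : ℝ) : EReal) := by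
    intro t h0 h1
    have hm1 : ((u, a + α * u ^ 2 / 2) : ℝ × ℝ) ∈
        {q : ℝ × ℝ | h q.1 + ((α * q.1 ^ 2 / 2 : ℝ) : EReal) ≤ (q.2 : EReal)} := by
      simp only [Set.mem_ofPred_eq, ha, ← EReal.coe_add, le_refl]
    have hm2 : ((y, b + α * y ^ 2 / 2) : ℝ × ℝ) ∈
        {q : ℝ × ℝ | h q.1 + ((α * q.1 ^ 2 / 2 : ℝ) : EReal) ≤ (q.2 : EReal)} := by
      simp only [Set.mem_ofPred_eq, hb, ← EReal.coe_add, le_refl]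
    have hm := hs hm1 hm2 (sub_nonneg.2 h1) h0 (sub_add_cancel 1 t)
    simp only [Set.mem_ofPred_eq, Prod.smul_mk, Prod.mk_add_mk, smul_eq_mul] at hm
    have hx : (1 - t) * u + t * y = u + t * d := by rw [hd]; ring
    rwa [hx] at hm
  have hε : ∀ ε : ℝ, 0 < ε → a + (v * d - α / 2 * d ^ 2) - b ≤ ε * |d| := by
    intro ε hε
    have htend : Tendsto (fun t : ℝ => u + t * d) (𝓝[>] 0) (𝓝 u) := by
      have : Tendsto (fun t : ℝ => u + t * d) (𝓝 0) (𝓝 (u + 0 * d)) :=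
        (Continuous.tendsto (by fun_prop) 0)
      rw [zero_mul, add_zero] at this
      exact this.mono_left nhdsWithin_le_nhds
    have hev : ∀ᶠ t in 𝓝[>] (0 : ℝ),
        a + (v * d - α / 2 * d ^ 2) - b - ε * |d| ≤ -(α / 2 * d ^ 2 * t) := by
      filter_upwards [htend.eventually (hv.2.2 ε hε), self_mem_nhdsWithin,
        Ioo_mem_nhdsGT (zero_lt_one' ℝ)] with t ht ht0 ht1
      have ht0' : 0 < t := ht0
      have h1 := hconv t ht0'.le ht1.2.le
      have h2 := (add_le_add_left ht _).trans h1
      rw [ha, add_sub_cancel_left, ← EReal.coe_add, ← EReal.coe_add, EReal.coe_le_coe_iff,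
        abs_mul, abs_of_pos ht0'] at h2
      have hy' : y = u + d := by rw [hd]; ring
      rw [hy'] at h2
      have h3 : t * (a + (v * d - α / 2 * d ^ 2) - b - ε * |d|) ≤ t * -(α / 2 * d ^ 2 * t) := by
        linarith
      exact le_of_mul_le_mul_left h3 ht0'
    have hlim : Tendsto (fun t : ℝ => -(α / 2 * d ^ 2 * t)) (𝓝[>] 0) (𝓝 0) := by
      have : Tendsto (fun t : ℝ => -(α / 2 * d ^ 2 * t)) (𝓝 0) (𝓝 (-(α / 2 * d ^ 2 * 0))) :=
        (Continuous.tendsto (by fun_prop) 0)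
      rw [mul_zero, neg_zero] at this
      exact this.mono_left nhdsWithin_le_nhds
    have := ge_of_tendsto hlim hev
    linarith
  have hlim : Tendsto (fun ε : ℝ => ε * |d|) (𝓝[>] 0) (𝓝 0) := by
    have : Tendsto (fun ε : ℝ => ε * |d|) (𝓝 0) (𝓝 (0 * |d|)) :=
      (Continuous.tendsto (by fun_prop) 0)
    rw [zero_mul] at this
    exact this.mono_left nhdsWithin_le_nhds
  have := ge_of_tendsto hlim (eventually_mem_nhdsWithin.mono fun ε hε' => hε ε hε')
  linarith

/-- First-order characterization of the proximal operator of a function that becomes strongly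
convex once `|·|² / 2` is added to it. -/
theorem prox_eq_of_mem_subdiff {h : ℝ → EReal} {α u v : ℝ} (hα : α < 1) (hs : SemiConvex α h)
    (hbot : ∀ x, h x ≠ ⊥) (hv : v ∈ subdiff h u) : prox h (u + v) = u := by
  obtain ⟨a, ha⟩ := exists_coe_of_mem_subdiff hv
  have hle := le_of_mem_subdiff hs hbot hv
  have hu : IsProx h (u + v) u := by
    intro y
    refine le_trans ?_ (add_le_add_left (hle y) _)
    rw [ha, ← EReal.coe_add, ← EReal.coe_add, ← EReal.coe_add, EReal.coe_le_coe_iff]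
    nlinarith [mul_nonneg (sub_nonneg.2 hα.le) (sq_nonneg (y - u))]
  have hw : IsProx h (u + v) (prox h (u + v)) := by
    have hex : ∃ w, IsProx h (u + v) w := ⟨u, hu⟩
    rw [prox, dif_pos hex]
    exact hex.choose_spec
  set w := prox h (u + v)
  have h1 := (add_le_add_left (hle w) (((w - (u + v)) ^ 2 / 2 : ℝ) : EReal)).trans (hw u)
  rw [ha, ← EReal.coe_add, ← EReal.coe_add, ← EReal.coe_add, EReal.coe_le_coe_iff] at h1
  have h2 : (1 - α) * (w - u) ^ 2 ≤ 0 := by nlinarith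
  have h3 : (w - u) ^ 2 = 0 := by
    have := sub_pos.2 hα
    nlinarith [sq_nonneg (w - u)]
  exact sub_eq_zero.1 (pow_eq_zero_iff two_ne_zero |>.1 h3)

theorem ProperClosedBelow.div_ne_bot {g : ℝ → EReal} (hg : ProperClosedBelow g) {L : ℝ}
    (hL : 0 < L) (x : ℝ) : g x / (L : EReal) ≠ ⊥ := by
  obtain ⟨m, hm⟩ := hg.bddBelow
  have h1 : ((m / L : ℝ) : EReal) ≤ g x / (L : EReal) := by
    rw [EReal.coe_div]
    exact EReal.div_le_div_right_of_nonneg (by exact_mod_cast hL.le) (hm x)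
  exact ne_bot_of_le_ne_bot (EReal.coe_ne_bot _) h1

/-- `prox_{g / L} (u + v / L) = u` for every subgradient `v` of `g` at `u`. -/
theorem prox_div_eq {g : ℝ → EReal} {α L u v : ℝ} (hα : α < 1) (hL : 0 < L)
    (hg : ProperClosedBelow g) (hs : SemiConvex α (fun x => g x / (L : EReal)))
    (hv : v ∈ subdiff g u) : prox (fun x => g x / (L : EReal)) (u + v / L) = u :=
  prox_eq_of_mem_subdiff hα hs (hg.div_ne_bot hL) (div_mem_subdiff hL hv)

/-- Fréchet subgradients of a separable function are subgradients coordinate by coordinate. -/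
theorem IsCritical.mem_subdiff {p : ℕ} {f : (Fin p → ℝ) → ℝ} {g : Fin p → ℝ → EReal}
    {β : Fin p → ℝ} (hcrit : IsCritical f g β) (j : Fin p) :
    -partialDeriv f j β ∈ subdiff (g j) (β j) := by
  obtain ⟨htop, hbot, hineq⟩ := hcrit
  set c : EReal := ∑ i ∈ Finset.univ.erase j, g i (β i) with hc
  have hpen : ∀ y, penalty g (Function.update β j y) = g j y + c := by
    intro y
    rw [penalty, ← Finset.add_sum_erase _ _ (Finset.mem_univ j), Function.update_self]
    congr 1
    refine Finset.sum_congr rfl fun i hi => ?_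
    rw [Function.update_of_ne (Finset.ne_of_mem_erase hi)]
  have hself : penalty g β = g j (β j) + c := by
    rw [← hpen, Function.update_eq_self]
  rw [hself] at htop hbot hineq
  have hg1 : g j (β j) ≠ ⊥ := fun h => hbot (by rw [h, EReal.bot_add])
  have hc1 : c ≠ ⊥ := fun h => hbot (by rw [h, EReal.add_bot])
  have hg2 : g j (β j) ≠ ⊤ := fun h => htop (by rw [h, EReal.top_add_of_ne_bot hc1])
  have hc2 : c ≠ ⊤ := fun h => htop (by rw [h, EReal.add_top_of_ne_bot hg1])
  rw [mem_subdiff_iff]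
  refine ⟨hg2, hg1, fun ε hε => ?_⟩
  have htend : Tendsto (fun y => Function.update β j y) (𝓝 (β j)) (𝓝 β) := by
    have : Continuous fun y : ℝ => Function.update β j y := continuous_const.update j continuous_id
    simpa using this.tendsto (β j)
  filter_upwards [htend.eventually (hineq ε hε)] with y hy
  have hdiff : Function.update β j y - β = (y - β j) • (Pi.single j 1 : Fin p → ℝ) := by
    ext i
    by_cases hi : i = j
    · subst hi
      simp
    · simp [hi]
  have hnorm : ‖(y - β j) • (Pi.single j 1 : Fin p → ℝ)‖ = |y - β j| := by
    rw [norm_smul, Pi.norm_single, norm_one, mul_one, Real.norm_eq_abs]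
  rw [hpen, hdiff, hnorm, map_smul, smul_eq_mul, _root_.neg_apply] at hy
  obtain ⟨c', hc'⟩ : ∃ c' : ℝ, c = c' := ⟨_, (EReal.coe_toReal hc2 hc1).symm⟩
  rw [hc', add_right_comm] at hy
  have h1 := (EReal.addLECancellable_coe c').add_le_add_iff_right.1 hy
  rwa [mul_comm (y - β j)] at h1

/-! ### Coordinate descent is affine near a non-degenerate critical point -/

/-- The coordinate update linearized at `β`, acting on errors `e = x - β`: outside the support the
error is set to zero, in the support it follows the gradient of the quadratic form with matrix
`hessian f g β`, with step `1 / γ j`. -/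
noncomputable def linStep {p : ℕ} (f : (Fin p → ℝ) → ℝ) (g : Fin p → ℝ → EReal) (β γ e : Fin p → ℝ)
    (j : Fin p) : Fin p → ℝ :=
  Function.update e j (if j ∈ gsupp g β then e j - (γ j)⁻¹ *
    (iteratedDeriv 2 (fun x => (g j x).toReal) (β j) * e j +
      ∑ i, e i * partialDeriv (partialDeriv f j) i β) else 0)

theorem linStep_apply_self {p : ℕ} {f : (Fin p → ℝ) → ℝ} {g : Fin p → ℝ → EReal}
    {β γ e : Fin p → ℝ} {j : Fin p} (hj : j ∉ gsupp g β) : linStep f g β γ e j j = 0 := by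
  rw [linStep, Function.update_self, if_neg hj]

theorem linStep_apply_of_ne {p : ℕ} {f : (Fin p → ℝ) → ℝ} {g : Fin p → ℝ → EReal}
    {β γ e : Fin p → ℝ} {i j : Fin p} (hij : i ≠ j) : linStep f g β γ e j i = e i :=
  Function.update_of_ne hij _ _

theorem tendsto_linStep {p : ℕ} (f : (Fin p → ℝ) → ℝ) (g : Fin p → ℝ → EReal)
    (β γ : Fin p → ℝ) (j : Fin p) :
    Tendsto (fun e => linStep f g β γ e j) (𝓝 0) (𝓝 0) := by
  have hc : Continuous fun e => linStep f g β γ e j := by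
    unfold linStep
    refine continuous_id.update j ?_
    split_ifs <;> fun_prop
  have h0 : linStep f g β γ 0 j = 0 := by simp [linStep]
  simpa [h0] using hc.tendsto 0

/-- Coordinates outside the support vanish as soon as they have been updated once. -/
theorem foldl_linStep_eq_zero {p : ℕ} {f : (Fin p → ℝ) → ℝ} {g : Fin p → ℝ → EReal}
    {β γ : Fin p → ℝ} {j : Fin p} (hj : j ∉ gsupp g β) (l : List (Fin p)) (e : Fin p → ℝ)
    (h : e j = 0 ∨ j ∈ l) : l.foldl (linStep f g β γ) e j = 0 := by
  induction l generalizing e with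
  | nil => simpa using h
  | cons i l ih =>
    rw [List.foldl_cons]
    apply ih
    by_cases hij : j = i
    · subst hij
      exact Or.inl (linStep_apply_self hj)
    · rw [linStep_apply_of_ne hij]
      simpa [hij] using h

theorem foldl_linStep_filter {p : ℕ} {f : (Fin p → ℝ) → ℝ} {g : Fin p → ℝ → EReal}
    {β γ : Fin p → ℝ} (l : List (Fin p)) (e : Fin p → ℝ) (h : ∀ j ∉ gsupp g β, e j = 0) :
    l.foldl (linStep f g β γ) e = (l.filter (· ∈ gsupp g β)).foldl (linStep f g β γ) e := by
  induction l generalizing e with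
  | nil => rfl
  | cons i l ih =>
    rw [List.foldl_cons]
    by_cases hi : i ∈ gsupp g β
    · rw [List.filter_cons_of_pos (by simpa using hi), List.foldl_cons]
      refine ih _ fun j hj => ?_
      rw [linStep_apply_of_ne (fun hji : j = i => hj (hji ▸ hi)), h j hj]
    · rw [List.filter_cons_of_neg (by simpa using hi)]
      have h1 : linStep f g β γ e i = e := by
        rw [linStep, if_neg hi, ← h i hi, Function.update_eq_self]
      rw [h1]
      exact ih e h

theorem extend_zero_apply {p : ℕ} {S : Finset (Fin p)} (u : S → ℝ) (j : S) :
    extend S 0 u j = u j := by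
  simp [extend]

theorem extend_zero_of_notMem {p : ℕ} {S : Finset (Fin p)} (u : S → ℝ) {j : Fin p} (hj : j ∉ S) :
    extend S 0 u j = 0 := by
  simp [extend, hj]

theorem eq_extend_zero {p : ℕ} {S : Finset (Fin p)} {e : Fin p → ℝ} {u : S → ℝ}
    (hS : ∀ j : S, e j = u j) (hSc : ∀ j ∉ S, e j = 0) : e = extend S 0 u := by
  ext j
  by_cases hj : j ∈ S
  · rw [hS ⟨j, hj⟩, extend_zero_apply u ⟨j, hj⟩]
  · rw [hSc j hj, extend_zero_of_notMem u hj]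

theorem sum_extend_zero_mul {p : ℕ} {S : Finset (Fin p)} (u : S → ℝ) (b : Fin p → ℝ) :
    ∑ i, extend S 0 u i * b i = ∑ i : S, u i * b i := by
  rw [← Finset.sum_subset (Finset.subset_univ S)
    (fun i _ hi => by rw [extend_zero_of_notMem u hi, zero_mul]), ← Finset.sum_coe_sort S]
  exact Finset.sum_congr rfl fun i _ => by rw [extend_zero_apply]

/-- On errors supported in the support, the linearized update is a coordinate step for the
Hessian. -/
theorem linStep_extend {p : ℕ} {f : (Fin p → ℝ) → ℝ} {g : Fin p → ℝ → EReal} {β γ : Fin p → ℝ}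
    (hH : (hessian f g β).PosDef) (u : gsupp g β → ℝ) (j : gsupp g β) :
    linStep f g β γ (extend (gsupp g β) 0 u) j = extend (gsupp g β) 0
      (coordMatrix (hessian f g β) (fun i => γ i) j *ᵥ u) := by
  have hHt : (hessian f g β)ᵀ = hessian f g β :=
    show (hessian f g β).IsSymm by simpa using hH.1
  refine eq_extend_zero (fun i => ?_) (fun i hi => ?_)
  · rw [coordMatrix_mulVec]
    by_cases hij : i = j
    · subst hij
      have h1 : (hessian f g β *ᵥ u) i =
          iteratedDeriv 2 (fun x => (g i x).toReal) (β i) * u i +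
            ∑ k : gsupp g β, u k * partialDeriv (partialDeriv f i) k β := by
        conv_lhs => rw [← hHt]
        simp only [mulVec, dotProduct, transpose_apply, hessian, Matrix.add_apply, of_apply,
          diagonal_apply, add_mul, Finset.sum_add_distrib, ite_mul, zero_mul, Finset.sum_ite_eq',
          Finset.mem_univ, if_true]
        rw [add_comm]
        simp only [mul_comm (u _)]
      rw [linStep, Function.update_self, if_pos i.2, extend_zero_apply, sum_extend_zero_mul]
      simp [h1]
    · rw [linStep_apply_of_ne (fun h => hij (Subtype.ext h)), extend_zero_apply]
      simp [hij]
  · rw [linStep_apply_of_ne (fun h : i = j => hi (h ▸ j.2)), extend_zero_of_notMem u hi]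

theorem foldl_linStep_extend {p : ℕ} {f : (Fin p → ℝ) → ℝ} {g : Fin p → ℝ → EReal}
    {β γ : Fin p → ℝ} (hH : (hessian f g β).PosDef) (l : List (gsupp g β)) (u : gsupp g β → ℝ) :
    (l.map Subtype.val).foldl (linStep f g β γ) (extend (gsupp g β) 0 u) =
      extend (gsupp g β) 0
        ((l.reverse.map (coordMatrix (hessian f g β) (fun i => γ i))).prod *ᵥ u) := by
  induction l generalizing u with
  | nil => simp
  | cons j l ih =>
    rw [List.map_cons, List.foldl_cons, linStep_extend hH, ih, mulVec_mulVec]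
    simp

/-- The coordinates in the support, in increasing order. -/
def suppList {p : ℕ} (S : Finset (Fin p)) : List S :=
  ((List.finRange p).filter (· ∈ S)).attachWith (· ∈ S) fun j hj => by
    simpa using (List.mem_filter.1 hj).2

theorem map_suppList {p : ℕ} (S : Finset (Fin p)) :
    (suppList S).map Subtype.val = (List.finRange p).filter (· ∈ S) :=
  List.attachWith_map_subtype_val _

theorem mem_suppList {p : ℕ} (S : Finset (Fin p)) (j : S) : j ∈ suppList S := by
  simp [suppList]

theorem foldl_linStep_symm {p : ℕ} {f : (Fin p → ℝ) → ℝ} {g : Fin p → ℝ → EReal}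
    {β γ : Fin p → ℝ} (hH : (hessian f g β).PosDef) (u : gsupp g β → ℝ) :
    let l := (List.finRange p).filter (· ∈ gsupp g β)
    (l ++ l.reverse).foldl (linStep f g β γ) (extend (gsupp g β) 0 u) = extend (gsupp g β) 0
      (sweepMatrix (hessian f g β) (fun i => γ i) (suppList (gsupp g β)) *ᵥ u) := by
  intro l
  have h1 : l ++ l.reverse =
      (suppList (gsupp g β) ++ (suppList (gsupp g β)).reverse).map Subtype.val := by
    rw [List.map_append, List.map_reverse, map_suppList]
  rw [h1, foldl_linStep_extend hH]
  simp [sweepMatrix]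

/-- The diagonal of the Hessian is bounded by the inverse step sizes. -/
theorem hessian_diag_le {p : ℕ} {f : (Fin p → ℝ) → ℝ} {g : Fin p → ℝ → EReal} {L : Fin p → ℝ}
    {β : Fin p → ℝ} (hf : SmoothPart f L) (hfq : PiecewiseQuadratic (fun x => (f x : EReal)))
    (hC2 : ContDiffAt ℝ 2 f β) (j : gsupp g β) :
    hessian f g β j j ≤ L j + iteratedDeriv 2 (fun x => (g j x).toReal) (β j) := by
  have htend : Tendsto (fun t : ℝ => β + t • (Pi.single (j : Fin p) 1 : Fin p → ℝ)) (𝓝[>] 0)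
      (𝓝 β) := by
    have : Tendsto (fun t : ℝ => β + t • (Pi.single (j : Fin p) 1 : Fin p → ℝ)) (𝓝 0)
        (𝓝 (β + (0 : ℝ) • (Pi.single (j : Fin p) 1 : Fin p → ℝ))) :=
      Continuous.tendsto (by fun_prop) 0
    rw [zero_smul, add_zero] at this
    exact this.mono_left nhdsWithin_le_nhds
  obtain ⟨t, ht, ht0⟩ := ((htend.eventually
    (partialDeriv_eventually_affine hfq hC2 (j : Fin p))).and self_mem_nhdsWithin).exists
  have ht0' : 0 < t := ht0
  have h1 := hf.lipschitz j β t
  have h2 : ∑ i, ((β + t • (Pi.single (j : Fin p) 1 : Fin p → ℝ)) i - β i) *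
      partialDeriv (partialDeriv f j) i β = t * partialDeriv (partialDeriv f j) j β := by
    rw [Finset.sum_eq_single (j : Fin p)]
    · simp
    · intro i _ hi
      simp [hi]
    · simp
  rw [ht, h2, add_sub_cancel_left, abs_mul, abs_of_pos ht0', mul_comm] at h1
  have h3 := (le_abs_self _).trans (le_of_mul_le_mul_right h1 ht0')
  simpa [hessian] using h3

/-- The proximal update at a non-degenerate critical point. Outside the support, a neighbourhood of
the prox argument is mapped to the same point, because the subdifferential has interior there; in
the support, the optimality condition of the prox is an affine equation. -/
theorem eventually_cdStep_eq {p : ℕ} {f : (Fin p → ℝ) → ℝ} {g : Fin p → ℝ → EReal}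
    {L : Fin p → ℝ} {α : ℝ} {β : Fin p → ℝ} (hf : SmoothPart f L)
    (hg : ∀ j, ProperClosedBelow (g j)) (hα : α < 1)
    (hsemi : ∀ j, SemiConvex α (fun x => g j x / (L j : EReal)))
    (hfq : PiecewiseQuadratic (fun x => (f x : EReal))) (hgq : ∀ j, PiecewiseQuadratic (g j))
    (hcrit : IsCritical f g β) (hnd : NonDegenerate f g β) (hC3 : LocallyC3 f g β)
    (hH : (hessian f g β).PosDef) (j : Fin p) :
    ∀ᶠ e in 𝓝 (0 : Fin p → ℝ), cdStep f g L (β + e) j = β + linStep f g β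
      (fun i => L i + iteratedDeriv 2 (fun x => (g i x).toReal) (β i)) e j := by
  have hfC2 : ContDiffAt ℝ 2 f β := hC3.1.of_le (by norm_num)
  have hL := hf.pos j
  have htend : Tendsto (fun e : Fin p → ℝ => β + e) (𝓝 0) (𝓝 β) := by
    have : Tendsto (fun e : Fin p → ℝ => β + e) (𝓝 0) (𝓝 (β + 0)) :=
      Continuous.tendsto (by fun_prop) 0
    rwa [add_zero] at this
  have haff := htend.eventually (partialDeriv_eventually_affine hfq hfC2 j)
  simp only [Pi.add_apply, add_sub_cancel_left] at haff
  set a : Fin p → ℝ := fun i => partialDeriv (partialDeriv f j) i β with ha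
  set d := partialDeriv f j β with hd
  have hupd : ∀ (e : Fin p → ℝ) (t : ℝ),
      Function.update (β + e) j (β j + t) = β + Function.update e j t := by
    intro e t
    ext i
    by_cases hi : i = j
    · subst hi
      simp
    · simp [hi]
  by_cases hj : j ∈ gsupp g β
  · obtain ⟨hfin, hgC3⟩ := hC3.2 j hj
    set G := fun x => (g j x).toReal with hG
    set q := iteratedDeriv 2 G (β j) with hq
    have hγ : 0 < L j + q := hH.diag_pos.trans_le (hessian_diag_le hf hfq hfC2 ⟨j, hj⟩)
    have hgC2 : ContDiffAt ℝ 2 G (β j) := hgC3.of_le (by norm_num)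
    have hcrit' : deriv G (β j) = -d := by
      obtain ⟨v, hv⟩ : ∃ v, subdiff (g j) (β j) = {v} := by simpa [gsupp] using hj
      have h1 := hcrit.mem_subdiff j
      have h2 : deriv G (β j) ∈ subdiff (g j) (β j) :=
        deriv_mem_subdiff hfin (hgC2.differentiableAt (by norm_num)).hasDerivAt
      rw [hv, Set.mem_singleton_iff] at h1 h2
      rw [h1, h2]
    have hsub : ∀ᶠ u in 𝓝 (β j), -d + q * (u - β j) ∈ subdiff (g j) u := by
      filter_upwards [hfin.eventually_nhds, hgC2.eventually (by simp),
        deriv_eventually_affine (hgq j) (hfin.mono fun x hx => hx.1) hgC2] with u h1 h2 h3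
      rw [← hcrit', ← h3]
      exact deriv_mem_subdiff h1 (h2.differentiableAt (by norm_num)).hasDerivAt
    have hu : Tendsto (fun e : Fin p → ℝ =>
        β j + (e j - (L j + q)⁻¹ * (q * e j + ∑ i, e i * a i))) (𝓝 0) (𝓝 (β j)) := by
      have : Tendsto (fun e : Fin p → ℝ =>
          β j + (e j - (L j + q)⁻¹ * (q * e j + ∑ i, e i * a i))) (𝓝 0)
          (𝓝 (β j + ((0 : Fin p → ℝ) j - (L j + q)⁻¹ *
            (q * (0 : Fin p → ℝ) j + ∑ i, (0 : Fin p → ℝ) i * a i)))) :=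
        Continuous.tendsto (by fun_prop) 0
      simpa using this
    filter_upwards [haff, hu.eventually hsub] with e he hv
    rw [cdStep, he, linStep, if_pos hj, ← hupd]
    congr 1
    rw [← prox_div_eq hα hL (hg j) (hsemi j) hv]
    congr 1
    rw [Pi.add_apply]
    field_simp
    ring
  · have hv : Tendsto (fun e : Fin p → ℝ => L j * e j - (d + ∑ i, e i * a i)) (𝓝 0)
        (𝓝 (-d)) := by
      have : Tendsto (fun e : Fin p → ℝ => L j * e j - (d + ∑ i, e i * a i)) (𝓝 0)
          (𝓝 (L j * (0 : Fin p → ℝ) j - (d + ∑ i, (0 : Fin p → ℝ) i * a i))) :=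
        Continuous.tendsto (by fun_prop) 0
      simpa using this
    filter_upwards [haff, hv.eventually (mem_interior_iff_mem_nhds.1 (hnd j hj))] with e he hv
    rw [cdStep, he, linStep, if_neg hj, ← hupd, add_zero]
    congr 1
    rw [← prox_div_eq hα hL (hg j) (hsemi j) hv]
    congr 1
    rw [Pi.add_apply]
    field_simp
    ring

theorem eventually_foldl_cdStep_eq {p : ℕ} {f : (Fin p → ℝ) → ℝ} {g : Fin p → ℝ → EReal}
    {L β γ : Fin p → ℝ}
    (hstep : ∀ j, ∀ᶠ e in 𝓝 (0 : Fin p → ℝ),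
      cdStep f g L (β + e) j = β + linStep f g β γ e j) (l : List (Fin p)) :
    ∀ᶠ e in 𝓝 (0 : Fin p → ℝ),
      l.foldl (cdStep f g L) (β + e) = β + l.foldl (linStep f g β γ) e := by
  induction l with
  | nil => simp
  | cons j l ih =>
    filter_upwards [hstep j, (tendsto_linStep f g β γ j).eventually ih] with e h1 h2
    rw [List.foldl_cons, List.foldl_cons, h1, h2]

/-! ### Anderson extrapolation of a linear iteration -/

theorem extend_zero_dotProduct {p : ℕ} {S : Finset (Fin p)} (u v : S → ℝ) :
    extend S 0 u ⬝ᵥ extend S 0 v = u ⬝ᵥ v := by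
  rw [dotProduct, sum_extend_zero_mul]
  exact Finset.sum_congr rfl fun i _ => by rw [extend_zero_apply]

/-- The extrapolation of an orbit `β + T ^ i e` is obtained by applying to `e` the polynomial that
minimizes the residual, and one more step of `T`. -/
theorem IsAndersonExtrapolation.exists_minimal {p M : ℕ} (hM : 0 < M) {S : Finset (Fin p)}
    {β : Fin p → ℝ} {T : Matrix S S ℝ} {e : S → ℝ} {x : Fin (M + 1) → Fin p → ℝ} {y : Fin p → ℝ}
    (hx : ∀ i, x i = β + extend S 0 (T ^ (i : ℕ) *ᵥ e)) (hy : IsAndersonExtrapolation x y) :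
    ∃ v, (T - 1) *ᵥ (restr S y - restr S β) = T *ᵥ v ∧ ∀ F : ℝ[X], F.natDegree ≤ M - 1 →
      F.eval 1 = 1 → ‖(WithLp.toLp 2 v : EuclideanSpace ℝ S)‖ ≤
        ‖(WithLp.toLp 2 (aeval T F *ᵥ ((T - 1) *ᵥ e)) : EuclideanSpace ℝ S)‖ := by
  obtain ⟨c, ⟨hc1, hcmin⟩, hyc⟩ := hy
  let P : (Fin M → ℝ) → ℝ[X] := fun c => ∑ i : Fin M, C (c i) * X ^ (i : ℕ)
  have hP : ∀ c u, aeval T (P c) *ᵥ u = ∑ i : Fin M, c i • (T ^ (i : ℕ) *ᵥ u) := by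
    intro c u
    simp only [P, map_sum, map_mul, aeval_C, map_pow, aeval_X, sum_mulVec,
      Algebra.algebraMap_eq_smul_one, smul_one_mul, smul_mulVec]
  have hU : ∀ c, (differences x).mulVec c = extend S 0 (aeval T (P c) *ᵥ ((T - 1) *ᵥ e)) := by
    intro c
    refine eq_extend_zero (fun j => ?_) (fun j hj => ?_)
    · rw [hP, Finset.sum_apply, mulVec, dotProduct]
      refine Finset.sum_congr rfl fun i _ => ?_
      have h1 : T ^ (i : ℕ) *ᵥ ((T - 1) *ᵥ e) = T ^ ((i : ℕ) + 1) *ᵥ e - T ^ (i : ℕ) *ᵥ e := by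
        rw [mulVec_mulVec, mul_sub, mul_one, ← pow_succ, sub_mulVec]
      simp only [differences, of_apply, hx, Pi.add_apply, extend_zero_apply, h1, Pi.smul_apply,
        Pi.sub_apply, smul_eq_mul, Fin.val_succ, Fin.val_castSucc]
      ring
    · rw [mulVec, dotProduct]
      refine Finset.sum_eq_zero fun i _ => ?_
      simp [differences, hx, extend_zero_of_notMem _ hj]
  have hye : restr S y - restr S β = T *ᵥ (aeval T (P c) *ᵥ e) := by
    have h1 : T *ᵥ (aeval T (P c) *ᵥ e) = ∑ i : Fin M, c i • (T ^ ((i : ℕ) + 1) *ᵥ e) := by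
      rw [hP, mulVec_sum]
      refine Finset.sum_congr rfl fun i _ => ?_
      rw [mulVec_smul, mulVec_mulVec, ← pow_succ']
    rw [h1, hyc]
    ext j
    simp only [restr, Pi.sub_apply, Finset.sum_apply, Pi.smul_apply, smul_eq_mul, hx, Pi.add_apply,
      extend_zero_apply, Fin.val_succ, mul_add, Finset.sum_add_distrib, ← Finset.sum_mul, hc1,
      one_mul, add_sub_cancel_left]
  have hcomm : (T - 1) * T * aeval T (P c) = T * aeval T (P c) * (T - 1) := by
    have h1 : T - 1 = aeval T (X - 1 : ℝ[X]) := by simp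
    have h2 : T = aeval T (X : ℝ[X]) := by simp
    rw [h1]
    nth_rewrite 2 4 [h2]
    simp only [← map_mul]
    congr 1
    ring
  refine ⟨aeval T (P c) *ᵥ ((T - 1) *ᵥ e), ?_, fun F hdeg hF1 => ?_⟩
  · rw [hye, mulVec_mulVec, mulVec_mulVec, mulVec_mulVec, mulVec_mulVec, hcomm]
  · have hFP : P (fun i => F.coeff i) = F := by
      conv_rhs => rw [F.as_sum_range' M (by omega)]
      rw [← Fin.sum_univ_eq_sum_range (fun i => monomial i (F.coeff i)) M]
      simp only [P, C_mul_X_pow_eq_monomial]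
    have hsum : ∑ i : Fin M, F.coeff i = 1 := by
      rw [← hF1]
      conv_rhs => rw [← hFP]
      simp [P, eval_finsetSum]
    have h1 := hcmin _ hsum
    rw [hU, hU, hFP, extend_zero_dotProduct, extend_zero_dotProduct] at h1
    rw [norm_toLp_eq_sqrt, norm_toLp_eq_sqrt]
    exact Real.sqrt_le_sqrt h1

/-! ### Anderson acceleration of an iteration that is linear on the support -/

/-- Along Anderson accelerated coordinate descent, once the epochs act on errors as the matrix `T`
on `S` and annihilate the coordinates off `S`, all iterates are supported in `S`: an extrapolation
combines results of epochs only. -/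
theorem IsAndersonCD.eq_off_support {p M : ℕ} {f : (Fin p → ℝ) → ℝ} {g : Fin p → ℝ → EReal}
    {L βhat : Fin p → ℝ} {β ex : ℕ → Fin p → ℝ} (hrun : IsAndersonCD f g L M β ex)
    {S : Finset (Fin p)} {k1 : ℕ} (hE : ∀ k, k1 ≤ k → ∀ j ∉ S, cdEpoch f g L (β k) j = βhat j)
    (k : ℕ) (hk : k1 + M ≤ k) : ∀ j ∉ S, β (k + 1) j = βhat j := by
  intro j hj
  by_cases hM : M ∣ k + 1
  · rcases hrun.choice k hM with h | h
    · obtain ⟨c, ⟨hc1, -⟩, hy⟩ := hrun.extrapolation k hM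
      rw [h, hy]
      have hx : ∀ i : Fin M, (Fin.snoc (α := fun _ => Fin p → ℝ)
          (fun i : Fin M => β (k + 1 - M + i)) (cdEpoch f g L (β k)) i.succ : Fin p → ℝ) j =
          βhat j := by
        intro i
        by_cases hi : (i : ℕ) + 1 < M
        · have h1 : i.succ = Fin.castSucc ⟨(i : ℕ) + 1, hi⟩ := rfl
          have h2 : ¬ M ∣ k + 1 - M + i + 1 := by
            have h3 : M ∣ k + 1 - M := Nat.dvd_sub hM dvd_rfl
            rw [add_assoc, Nat.dvd_add_right h3]
            exact fun h => absurd (Nat.le_of_dvd (Nat.succ_pos _) h) (by omega)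
          rw [h1, Fin.snoc_castSucc]
          change β (k + 1 - M + i + 1) j = _
          rw [hrun.epoch _ h2]
          exact hE _ (by omega) j hj
        · have h1 : i.succ = Fin.last M := by
            ext
            simp only [Fin.val_succ, Fin.val_last]
            omega
          rw [h1, Fin.snoc_last]
          exact hE k (by omega) j hj
      simp only [Finset.sum_apply, Pi.smul_apply, hx, smul_eq_mul, ← Finset.sum_mul, hc1, one_mul]
    · rw [h]
      exact hE k (by omega) j hj
  · rw [hrun.epoch k hM]
    exact hE k (by omega) j hj

/-- An accepted extrapolation replaces the residual by `T v`, where `v` is the smallest residual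
that a polynomial of degree less than `M` and of value `1` at `1` can produce. -/
theorem IsAndersonCD.exists_minimal {p M : ℕ} {f : (Fin p → ℝ) → ℝ} {g : Fin p → ℝ → EReal}
    {L βhat : Fin p → ℝ} {β ex : ℕ → Fin p → ℝ} (hM : 0 < M) (hrun : IsAndersonCD f g L M β ex)
    {S : Finset (Fin p)} {T : Matrix S S ℝ} {k2 : ℕ}
    (hoff : ∀ k, k2 ≤ k → ∀ j ∉ S, β k j = βhat j)
    (hE : ∀ k, k2 ≤ k →
      cdEpoch f g L (β k) = βhat + extend S 0 (T *ᵥ (restr S (β k) - restr S βhat)))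
    (k : ℕ) (hk : k2 + M ≤ k + 1) (hdvd : M ∣ k + 1) :
    ∃ v, (T - 1) *ᵥ (restr S (ex (k + 1)) - restr S βhat) = T *ᵥ v ∧
      ∀ F : ℝ[X], F.natDegree ≤ M - 1 → F.eval 1 = 1 →
        ‖(WithLp.toLp 2 v : EuclideanSpace ℝ S)‖ ≤ ‖(WithLp.toLp 2 (aeval T F *ᵥ
          ((T - 1) *ᵥ (restr S (β (k + 1 - M)) - restr S βhat))) : EuclideanSpace ℝ S)‖ := by
  set k' := k + 1 - M with hk'
  set e := restr S (β k') - restr S βhat with he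
  have hdvd' : M ∣ k' := Nat.dvd_sub hdvd dvd_rfl
  have hrestr : ∀ u : S → ℝ, restr S (βhat + extend S 0 u) - restr S βhat = u := by
    intro u
    ext j
    simp [restr, extend_zero_apply]
  have horbit : ∀ i, i < M → β (k' + i) = βhat + extend S 0 (T ^ i *ᵥ e) := by
    intro i
    induction i with
    | zero =>
      intro _
      rw [← sub_eq_iff_eq_add']
      refine eq_extend_zero (fun j => ?_) (fun j hj => ?_)
      · simp [he, restr]
      · rw [Pi.sub_apply, hoff _ (by omega) j hj, sub_self]
    | succ i ih =>
      intro hi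
      have h2 : ¬ M ∣ k' + i + 1 := by
        rw [add_assoc, Nat.dvd_add_right hdvd']
        exact fun h => absurd (Nat.le_of_dvd (Nat.succ_pos _) h) (by omega)
      rw [← add_assoc, hrun.epoch _ h2, hE _ (by omega), ih (by omega), hrestr, mulVec_mulVec,
        ← pow_succ']
  refine IsAndersonExtrapolation.exists_minimal hM (e := e) (fun i => ?_)
    (hrun.extrapolation k hdvd)
  refine Fin.lastCases ?_ (fun i => ?_) i
  · have h1 : k = k' + (M - 1) := by omega
    rw [Fin.snoc_last, hE k (by omega), Fin.val_last]
    conv_lhs => rw [h1, horbit (M - 1) (by omega), hrestr, mulVec_mulVec, ← pow_succ']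
    rw [Nat.sub_add_cancel hM]
  · rw [Fin.snoc_castSucc, Fin.val_castSucc]
    exact horbit i i.2

theorem jacobian_affine {n : Type*} [Fintype n] [DecidableEq n] (T : Matrix n n ℝ) (b : n → ℝ)
    (x : n → ℝ) : jacobian (fun u => b + T *ᵥ (u - b)) x = T := by
  have h1 : HasFDerivAt (fun u : n → ℝ => b + T *ᵥ (u - b))
      (LinearMap.toContinuousLinearMap T.mulVecLin) x := by
    have := (((LinearMap.toContinuousLinearMap T.mulVecLin).hasFDerivAt (x := x - b)).comp x
      ((hasFDerivAt_id x).sub_const b)).const_add b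
    exact this
  rw [jacobian, h1.fderiv]
  exact LinearMap.toMatrix'_toLin' T

/-- The accelerated rate, for the residuals `w k` of an iteration whose linear part is a symmetric
sweep `T`. -/
theorem exists_accelerated_index {n : Type*} [Fintype n] [DecidableEq n] {H : Matrix n n ℝ}
    (hH : H.PosDef) {γ : n → ℝ} (hγ : ∀ j, H j j ≤ γ j) {l : List n} (hl : ∀ j, j ∈ l) {M : ℕ}
    (hM : 0 < M) (w : ℕ → n → ℝ) (k0 : ℕ) :
    let T := sweepMatrix H γ l
    let r := rate (condNumber H) (specRadius T) M
    ∀ (_ : ∀ k, k0 ≤ k → ¬ M ∣ k + 1 → w (k + 1) = T *ᵥ w k)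
      (_ : ∀ k, k0 + M ≤ k + 1 → M ∣ k + 1 →
        (w (k + 1) = T *ᵥ w k ∧ specRadius T ^ M < r) ∨
        ∃ v, w (k + 1) = T *ᵥ v ∧ ∀ F : ℝ[X], F.natDegree ≤ M - 1 → F.eval 1 = 1 →
          ‖(WithLp.toLp 2 v : EuclideanSpace ℝ n)‖ ≤
            ‖(WithLp.toLp 2 (aeval T F *ᵥ w (k + 1 - M)) : EuclideanSpace ℝ n)‖),
    ∃ K, k0 ≤ K ∧ ∀ k, K ≤ k → ‖(WithLp.toLp 2 (w k) : EuclideanSpace ℝ n)‖ ≤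
      r ^ (((k : ℝ) - K) / M) * ‖(WithLp.toLp 2 (w K) : EuclideanSpace ℝ n)‖ := by
  intro T r hstep hcyc
  obtain ⟨hρ1, hpoly⟩ := sweepMatrix_spectral hH hγ hl
  change specRadius T < 1 at hρ1
  -- If `T = 0`, then `r` may be zero as well, but a single step ends the iteration.
  by_cases hT : T = 0
  · have hw : ∀ k, k0 + M ≤ k → w (k + 1) = 0 := by
      intro k hk
      by_cases hd : M ∣ k + 1
      · rcases hcyc k (by omega) hd with ⟨h, -⟩ | ⟨v, h, -⟩ <;> rw [h, hT, zero_mulVec]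
      · rw [hstep k (by omega) hd, hT, zero_mulVec]
    refine ⟨k0 + M + 1, by omega, fun k hk => ?_⟩
    obtain ⟨k, rfl⟩ : ∃ k', k = k' + 1 := ⟨k - 1, by omega⟩
    rw [hw k (by omega), hw (k0 + M) le_rfl]
    simp
  · -- A nonzero sweep has a positive spectral radius, and lives in a space of positive dimension.
    have hne : ∀ c : ℝ, 0 ≤ c → specRadius T ≤ c → √(condNumber H) * c ≠ 0 := by
      intro c hc hρc h0
      apply hT
      have h1 : ∀ v, T *ᵥ v = 0 := by
        intro v
        have h2 := hpoly X c hc (fun x hx => by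
          rw [eval_X, abs_of_nonneg hx.1]
          exact hx.2.trans hρc) v
        rw [h0, zero_mul, aeval_X, norm_le_zero_iff] at h2
        exact (WithLp.toLp_eq_zero 2).1 h2
      exact Matrix.ext_of_mulVec_single fun i => by rw [h1, zero_mulVec]
    have hρ0 : 0 < specRadius T := by
      refine lt_of_le_of_ne ENNReal.toReal_nonneg fun h => hne 0 le_rfl h.symm.le ?_
      rw [mul_zero]
    have hκ0 : 0 < √(condNumber H) := by
      refine lt_of_le_of_ne (Real.sqrt_nonneg _) fun h => hne 1 zero_le_one hρ1.le ?_
      rw [← h, zero_mul]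
    have hz := zeta_pos hρ0
    have hr0 : 0 < r := mul_pos hκ0 (by positivity)
    -- The decay per cycle: `ρ r` for an acceptance, `ρ ^ M` for a rejection if there can be any.
    obtain ⟨s, hs0, hrs, hsr, hs⟩ : ∃ s, 0 ≤ s ∧ specRadius T * r ≤ s ∧ s < r ∧
        (specRadius T ^ M < r → specRadius T ^ M ≤ s) := by
      have h1 : specRadius T * r < r := by nlinarith
      by_cases h : specRadius T ^ M < r
      · exact ⟨max (specRadius T * r) (specRadius T ^ M), by positivity, le_max_left _ _,
          max_lt h1 h, fun _ => le_max_right _ _⟩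
      · exact ⟨specRadius T * r, by positivity, le_rfl, h1, fun h' => absurd h' h⟩
    obtain ⟨C, hC⟩ := residual_decay hρ0 hρ1 hκ0.le hpoly hM hs0 hrs w k0 hstep
      fun k hk hd => (hcyc k hk hd).imp (fun h => ⟨h.1, hs h.2⟩) id
    exact exists_rate_index (y := fun k => ‖(WithLp.toLp 2 (w k) : EuclideanSpace ℝ n)‖)
      (fun k => norm_nonneg _) hM hs0 hsr (k0 + 1) hC k0

/-- Near a non-degenerate critical point, symmetric coordinate descent identifies the support and
acts there as the sweep `T` of the quadratic form with matrix `hessian f g βhat`; the residuals of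
its Anderson acceleration then decay at the accelerated rate. -/
theorem exists_sweep_linearization {p : ℕ} {f : (Fin p → ℝ) → ℝ} {g : Fin p → ℝ → EReal}
    {L : Fin p → ℝ} {α : ℝ} {M : ℕ} {βhat : Fin p → ℝ} {β ex : ℕ → Fin p → ℝ}
    (hM : 0 < M) (hf : SmoothPart f L) (hg : ∀ j, ProperClosedBelow (g j)) (hα : α < 1)
    (hsemi : ∀ j, SemiConvex α (fun x => g j x / (L j : EReal)))
    (hfq : PiecewiseQuadratic (fun x => (f x : EReal))) (hgq : ∀ j, PiecewiseQuadratic (g j))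
    (hcrit : IsCritical f g βhat) (hrun : IsAndersonCD f g L M β ex)
    (hconv : Tendsto β atTop (𝓝 βhat)) (hnd : NonDegenerate f g βhat) (hC3 : LocallyC3 f g βhat)
    (hH : (hessian f g βhat).PosDef) :
    ∃ (K : ℕ) (T : Matrix (gsupp g βhat) (gsupp g βhat) ℝ),
      (∀ᶠ u in 𝓝 (restr (gsupp g βhat) βhat), fixedPointMap f g L βhat u =
        restr (gsupp g βhat) βhat + T *ᵥ (u - restr (gsupp g βhat) βhat)) ∧
      (∀ k, K ≤ k → (∀ j, j ∉ gsupp g βhat → β k j = βhat j) ∧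
        restr (gsupp g βhat) (cdEpoch f g L (β k)) = restr (gsupp g βhat) βhat +
          T *ᵥ (restr (gsupp g βhat) (β k) - restr (gsupp g βhat) βhat)) ∧
      specRadius T < 1 ∧
      (((∀ᶠ k in atTop, M ∣ k → β k = ex k) ∨
          specRadius T ^ M < rate (condNumber (hessian f g βhat)) (specRadius T) M) →
        ∀ k, K ≤ k →
        matNorm ((T - 1)ᵀ * (T - 1))
            (restr (gsupp g βhat) (β k) - restr (gsupp g βhat) βhat) ≤
          rate (condNumber (hessian f g βhat)) (specRadius T) M ^ (((k : ℝ) - K) / M) *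
            matNorm ((T - 1)ᵀ * (T - 1))
              (restr (gsupp g βhat) (β K) - restr (gsupp g βhat) βhat)) := by
  set S := gsupp g βhat with hS
  set H := hessian f g βhat with hHdef
  set γ : Fin p → ℝ := fun i => L i + iteratedDeriv 2 (fun x => (g i x).toReal) (βhat i) with hγdef
  have hγ : ∀ j : S, H j j ≤ γ j := hessian_diag_le hf hfq (hC3.1.of_le (by norm_num))
  set T := sweepMatrix H (fun i => γ i) (suppList S) with hT
  have hl := mem_suppList S
  have hstep : ∀ j, ∀ᶠ e in 𝓝 (0 : Fin p → ℝ),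
      cdStep f g L (βhat + e) j = βhat + linStep f g βhat γ e j :=
    eventually_cdStep_eq hf hg hα hsemi hfq hgq hcrit hnd hC3 hH
  set lS := (List.finRange p).filter (· ∈ S) with hlS
  -- One epoch on an error `e`, and on an error supported in `S`.
  have hepoch := eventually_foldl_cdStep_eq hstep (List.finRange p ++ (List.finRange p).reverse)
  have hsub := eventually_foldl_cdStep_eq hstep (lS ++ lS.reverse)
  have hlin : ∀ u : S → ℝ, (List.finRange p ++ (List.finRange p).reverse).foldl
      (linStep f g βhat γ) (extend S 0 u) = extend S 0 (T *ᵥ u) := by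
    intro u
    rw [foldl_linStep_filter _ _ fun j hj => extend_zero_of_notMem u hj, List.filter_append,
      List.filter_reverse]
    exact foldl_linStep_symm hH u
  have hrestr : ∀ u : S → ℝ, restr S (βhat + extend S 0 u) = restr S βhat + u := by
    intro u
    ext j
    simp [restr, extend_zero_apply]
  have herr : Tendsto (fun k => β k - βhat) atTop (𝓝 0) := by
    simpa using hconv.sub_const βhat
  obtain ⟨k1, hk1⟩ := eventually_atTop.1 (herr.eventually hepoch)
  simp only [add_sub_cancel] at hk1
  have hoff0 : ∀ k, k1 ≤ k → ∀ j ∉ S, cdEpoch f g L (β k) j = βhat j := by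
    intro k hk j hj
    have h1 : cdEpoch f g L (β k) = _ := hk1 k hk
    rw [h1, Pi.add_apply, foldl_linStep_eq_zero hj _ _ (Or.inr (by simp)), add_zero]
  have hoff : ∀ k, k1 + M + 1 ≤ k → ∀ j ∉ S, β k j = βhat j := by
    intro k hk
    obtain ⟨k, rfl⟩ : ∃ k', k = k' + 1 := ⟨k - 1, by omega⟩
    exact hrun.eq_off_support hoff0 k (by omega)
  have hE : ∀ k, k1 + M + 1 ≤ k →
      cdEpoch f g L (β k) = βhat + extend S 0 (T *ᵥ (restr S (β k) - restr S βhat)) := by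
    intro k hk
    have h1 : cdEpoch f g L (β k) = _ := hk1 k (by omega)
    have h2 : β k - βhat = extend S 0 (restr S (β k) - restr S βhat) :=
      eq_extend_zero (fun j => rfl) (fun j hj => by rw [Pi.sub_apply, hoff k hk j hj, sub_self])
    rw [h1, h2, hlin]
  have hfix : ∀ᶠ u in 𝓝 (restr S βhat),
      fixedPointMap f g L βhat u = restr S βhat + T *ᵥ (u - restr S βhat) := by
    have htend : Tendsto (fun u : S → ℝ => extend S 0 (u - restr S βhat)) (𝓝 (restr S βhat))
        (𝓝 0) := by
      have hc : Continuous fun u : S → ℝ => extend S 0 (u - restr S βhat) := by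
        refine continuous_pi fun j => ?_
        by_cases hj : j ∈ S
        · simp only [extend, hj, dif_pos]
          fun_prop
        · simp only [extend_zero_of_notMem _ hj]
          fun_prop
      have h0 : extend S 0 (restr S βhat - restr S βhat) = 0 := by
        ext j
        simp [extend]
      have h1 := hc.tendsto (restr S βhat)
      rwa [h0] at h1
    filter_upwards [htend.eventually hsub] with u hu
    have h1 : extend S βhat u = βhat + extend S 0 (u - restr S βhat) := by
      ext j
      by_cases hj : j ∈ S <;> simp [extend, hj, restr]
    change restr S ((lS ++ lS.reverse).foldl (cdStep f g L) (extend S βhat u)) = _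
    rw [h1, hu, foldl_linStep_symm hH, hrestr]
  have hid : ∀ k, k1 + M + 1 ≤ k → (∀ j, j ∉ S → β k j = βhat j) ∧
      restr S (cdEpoch f g L (β k)) =
        restr S βhat + T *ᵥ (restr S (β k) - restr S βhat) := fun k hk =>
    ⟨hoff k hk, by rw [hE k hk, hrestr]⟩
  have hρ : specRadius T < 1 := (sweepMatrix_spectral hH hγ hl).1
  by_cases hacc : (∀ᶠ k in atTop, M ∣ k → β k = ex k) ∨
      specRadius T ^ M < rate (condNumber H) (specRadius T) M
  swap
  · exact ⟨k1 + M + 1, T, hfix, hid, hρ, fun h => absurd h hacc⟩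
  set w : ℕ → S → ℝ := fun k => (T - 1) *ᵥ (restr S (β k) - restr S βhat) with hw
  have hwE : ∀ k, k1 + M + 1 ≤ k → β (k + 1) = cdEpoch f g L (β k) → w (k + 1) = T *ᵥ w k := by
    intro k hk h
    simp only [hw]
    rw [h, hE k hk, hrestr, add_sub_cancel_left, mulVec_mulVec, mulVec_mulVec, sub_mul, mul_sub,
      one_mul, mul_one]
  have hcases : ∀ᶠ k in atTop, M ∣ k + 1 → (β (k + 1) = cdEpoch f g L (β k) ∧
      specRadius T ^ M < rate (condNumber H) (specRadius T) M) ∨ β (k + 1) = ex (k + 1) := by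
    rcases hacc with h | h
    · filter_upwards [(tendsto_add_atTop_nat 1).eventually h] with k hk hd using Or.inr (hk hd)
    · filter_upwards with k hd
      exact (hrun.choice k hd).symm.imp (fun h' => ⟨h', h⟩) id
  obtain ⟨k3, hk3⟩ := eventually_atTop.1 hcases
  set k0 := max k3 (k1 + M + 1) with hk0
  have h3 : k3 ≤ k0 := le_max_left _ _
  have h1 : k1 + M + 1 ≤ k0 := le_max_right _ _
  obtain ⟨K, hK, hrate⟩ := exists_accelerated_index hH hγ hl hM w k0
    (fun k hk hd => hwE k (h1.trans hk) (hrun.epoch k hd))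
    (fun k hk hd => by
      refine (hk3 k (by omega) hd).imp (fun h => ⟨hwE k (by omega) h.1, h.2⟩) fun h => ?_
      obtain ⟨v, hv, hmin⟩ := hrun.exists_minimal hM hoff hE k (by omega) hd
      exact ⟨v, by rw [← hv, ← h], hmin⟩)
  refine ⟨K, T, hfix, fun k hk => hid k (h1.trans (hK.trans hk)), hρ, fun _ k hk => ?_⟩
  rw [matNorm_residual, matNorm_residual]
  exact hrate k hk

end AndersonCD

theorem mainTheorem2 {p : ℕ} (f : (Fin p → ℝ) → ℝ) (g : Fin p → ℝ → EReal) (L : Fin p → ℝ)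
    (α : ℝ) (M : ℕ) (βhat : Fin p → ℝ) (β ex : ℕ → Fin p → ℝ)
    (hM : 0 < M)
    (hf : AndersonCD.SmoothPart f L)
    (hg : ∀ j, AndersonCD.ProperClosedBelow (g j))
    (hα : α < 1)
    (hsemi : ∀ j, AndersonCD.SemiConvex α (fun x => g j x / (L j : EReal)))
    (hfq : AndersonCD.PiecewiseQuadratic (fun x => (f x : EReal)))
    (hgq : ∀ j, AndersonCD.PiecewiseQuadratic (g j))
    (hcrit : AndersonCD.IsCritical f g βhat)
    (hrun : AndersonCD.IsAndersonCD f g L M β ex)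
    (hconv : Tendsto β atTop (𝓝 βhat))
    (hnd : AndersonCD.NonDegenerate f g βhat)
    (hC3 : AndersonCD.LocallyC3 f g βhat)
    (hH : (AndersonCD.hessian f g βhat).PosDef) :
    ∃ (K : ℕ) (ψ : (AndersonCD.gsupp g βhat → ℝ) → (AndersonCD.gsupp g βhat → ℝ)),
      let S := AndersonCD.gsupp g βhat
      let T := AndersonCD.jacobian ψ (AndersonCD.restr S βhat)
      let H := AndersonCD.hessian f g βhat
      let B := (T - 1).transpose * (T - 1)
      ContDiff ℝ 1 ψ ∧
      ψ =ᶠ[𝓝 (AndersonCD.restr S βhat)] AndersonCD.fixedPointMap f g L βhat ∧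
      (∀ k, K ≤ k → (∀ j, j ∉ S → β k j = βhat j) ∧
        AndersonCD.restr S (AndersonCD.cdEpoch f g L (β k)) = ψ (AndersonCD.restr S (β k))) ∧
      AndersonCD.specRadius T < 1 ∧
      (((∀ᶠ k in atTop, M ∣ k → β k = ex k) ∨
          AndersonCD.specRadius T ^ M <
            AndersonCD.rate (AndersonCD.condNumber H) (AndersonCD.specRadius T) M) →
        ∀ k, K ≤ k →
        AndersonCD.matNorm B (AndersonCD.restr S (β k) - AndersonCD.restr S βhat) ≤
          AndersonCD.rate (AndersonCD.condNumber H) (AndersonCD.specRadius T) M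
              ^ (((k : ℝ) - K) / M) *
            AndersonCD.matNorm B (AndersonCD.restr S (β K) - AndersonCD.restr S βhat)) := by
  obtain ⟨K, T, hfix, hid, hρ, hrate⟩ := AndersonCD.exists_sweep_linearization hM hf hg hα hsemi
    hfq hgq hcrit hrun hconv hnd hC3 hH
  refine ⟨K, fun u => AndersonCD.restr (AndersonCD.gsupp g βhat) βhat +
    T.mulVec (u - AndersonCD.restr (AndersonCD.gsupp g βhat) βhat), ?_⟩
  simp only [AndersonCD.jacobian_affine]
  refine ⟨?_, hfix.mono fun u hu => hu.symm, hid, hρ, hrate⟩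
  have h1 : ContDiff ℝ 1 fun u : AndersonCD.gsupp g βhat → ℝ => T.mulVecLin u :=
    (LinearMap.toContinuousLinearMap T.mulVecLin).contDiff
  exact contDiff_const.add (h1.comp (contDiff_id.sub contDiff_const))
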